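/- Let $f_0\colon\mathbb R^n\to\mathbb R$ and $F\colon\mathbb R^n\to\mathbb R^m$ be twice continuously differentiable, let $g\colon\mathbb R^m\to\mathbb R\cup\{-\infty,\infty\}$ be proper, lower semicontinuous and convex, and put $f(x,u):=f_0(x)+g(F(x)+u)$ and $L(x,y):=f_0(x)+y^\top F(x)$. All spaces carry Euclidean norms. **Notation.** For a set $C$ in a Euclidean space and $x\in C$ let $$T_C(x):=\{d\mid \exists\, d_k\to d,\ t_k\downarrow 0:\ x+t_kd_k\in C\ \forall k\},$$ $$T^{\#}_C(x):=\{d\mid\exists\, x_k\to x,\ d_k\to d:\ x_k\in C,\ d_k\in T_C(x_k)\ \forall k\},$$ let $\widehat N_C(x):=\{\eta\mid \eta^\top(x'-x)\le o(\|x'-x\|)\ \forall x'\in C\}$ be the regular normal cone, and let $$N_C(x):=\{\eta\mid\exists\,x_k\to x,\ \eta_k\to\eta:\ x_k\in C,\ \eta_k\in\widehat N_C(x_k)\ \forall k\}$$ be the limiting normal cone. For an extended-real-valued $h$ that is finite at $x$, let $\partial h(x):=\{z\mid(z,-1)\in N_{\operatorname{epi}h}(x,h(x))\}$ and $\partial^\infty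 h(x):=\{z\mid(z,0)\in N_{\operatorname{epi}h}(x,h(x))\}$; where $h$ is not finite, both sets are empty. For a set-valued mapping $\Upsilon$, let $\operatorname{gph}\Upsilon:=\{(x,y)\mid y\in\Upsilon(x)\}$, let $\operatorname{dom}\Upsilon:=\{x\mid\Upsilon(x)\neq\emptyset\}$, and let the limiting graphical derivative $D^{\#}\Upsilon(x,y)$ be the set-valued mapping with graph $T^{\#}_{\operatorname{gph}\Upsilon}(x,y)$. * $\Upsilon$ is *isolatedly calm at* $(x,y)\in\operatorname{gph}\Upsilon$ *with constant* $\kappa$ if there is a neighborhood $V$ of $y$ such that $\|y'-y\|\le\kappa\|x'-x\|$ for all $x'$ and all $y'\in\Upsilon(x')\cap V$. It is *isolatedly calm around* $(x,y)\in\operatorname{gph}\Upsilon$ if there are $\kappa>0$ and a neighborhood $W$ of $(x,y)$ such that it is isolatedly calm with constant $\kappa$ at all points of $W\cap\operatorname{gph}\Upsilon$. * $\Upsilon$ is *inner calm\* in the fuzzy sense* w.r.t. $\operatorname{dom}\Upsilon$ at $x$ in direction $d$ if $d\notin T_{\operatorname{dom}\Upsilon}(x)$, or if there is $\kappa_d>0$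 for which there exist $y$ and sequences $d_k\to d$, $t_k\downarrow0$, $y_k\to y$ with $y_k\in\Upsilon(x+t_kd_k)$ and $\|y_k-y\|\le\kappa_dt_k\|d_k\|$ for all $k$. Its modulus is $0$ if $d\notin T_{\operatorname{dom}\Upsilon}(x)$, and the infimum of all such $\kappa_d$ otherwise. * $\Upsilon$ is *locally uniformly inner calm\* in the fuzzy sense* w.r.t. $\operatorname{dom}\Upsilon$ at $x$ in direction $d$ if there are neighborhoods $U$ of $x$ and $N$ of $d$ and a constant $\kappa>0$ such that, at each $x'\in U\cap\operatorname{dom}\Upsilon$ and in each direction $d'\in N$, $\Upsilon$ is inner calm\* in the fuzzy sense w.r.t. $\operatorname{dom}\Upsilon$ with modulus at most $\kappa$. Define $M(v,u):=\{x\mid v\in\partial_xf(x,u)\}$, where $\partial_xf(x,u)$ is the limiting subdifferential of $f(\cdot,u)$ at $x$, and $Y(v,u,x):=\{y\mid(v,y)\in\partial f(x,u)\}$. Let $\bar x$ satisfy $0\in\partial_xf(\bar x,0)$. A multiplier $\bar y\in Y(0,0,\bar x)$ is called *strongly noncritical* for $\bar x$ if, for all $(d^x,d^y)\in\mathbb R^n\times\mathbb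 R^m$, $$\nabla^2_{xx}L(\bar x,\bar y)d^x+F'(\bar x)^\top d^y=0,\quad d^y\in D^{\#}(\partial g)(F(\bar x),\bar y)(F'(\bar x)d^x)\quad\Longrightarrow\quad d^x=0.$$ **Corollary.** Consider the following statements. 1. $M$ is isolatedly calm around $((0,0),\bar x)$. 2. Each $\bar y\in Y(0,0,\bar x)$ is strongly noncritical for $\bar x$, and $Y$ is locally uniformly inner calm\* in the fuzzy sense w.r.t. $\operatorname{dom}Y$ at $(0,0,\bar x)$ in each direction $(0,0,d^x)$ with $d^x\neq0$. Then (1) always implies (2). If the basic qualification condition $$F'(\bar x)^\top y=0,\ y\in\partial^\infty g(F(\bar x))\quad\Longrightarrow\quad y=0$$ holds, then (2) implies (1). -/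

import Mathlib

open Filter Topology

noncomputable section

namespace CritMult

/-- The Euclidean space `ℝⁿ`. -/
abbrev R (n : ℕ) := EuclideanSpace ℝ (Fin n)

/-- The product `X × Y` with the Euclidean product norm (and inner product). -/
abbrev L2Prod (X Y : Type*) := WithLp 2 (X × Y)

/-- The pair `(x, y)` as a point of the Euclidean product. -/
abbrev pair {X Y : Type*} (x : X) (y : Y) : L2Prod X Y := WithLp.toLp 2 (x, y)

section Cones

/-- The (Bouligand) tangent cone to `C` at `x`. -/
def tangentCone {E : Type*} [NormedAddCommGroup E] [NormedSpace ℝ E] (C : Set E) (x : E) :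
    Set E :=
  {d | ∃ (dk : ℕ → E) (tk : ℕ → ℝ), Tendsto dk atTop (𝓝 d) ∧
    (∀ k, 0 < tk k) ∧ Tendsto tk atTop (𝓝 0) ∧ ∀ k, x + tk k • dk k ∈ C}

/-- The limiting tangent cone to `C` at `x`. -/
def limitingTangentCone {E : Type*} [NormedAddCommGroup E] [NormedSpace ℝ E] (C : Set E) (x : E) :
    Set E :=
  {d | ∃ (xk dk : ℕ → E), Tendsto xk atTop (𝓝 x) ∧ Tendsto dk atTop (𝓝 d) ∧
    ∀ k, xk k ∈ C ∧ dk k ∈ tangentCone C (xk k)}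

/-- The regular (Fréchet) normal cone to `C` at `x`:
`⟪η, x' - x⟫ ≤ o(‖x' - x‖)` for `x' ∈ C`. -/
def regularNormalCone {E : Type*} [NormedAddCommGroup E] [InnerProductSpace ℝ E] (C : Set E)
    (x : E) : Set E :=
  {η | ∀ ε : ℝ, 0 < ε → ∀ᶠ x' in 𝓝[C] x, inner ℝ η (x' - x) ≤ ε * ‖x' - x‖}

/-- The limiting (Mordukhovich) normal cone to `C` at `x`. -/
def limitingNormalCone {E : Type*} [NormedAddCommGroup E] [InnerProductSpace ℝ E] (C : Set E)
    (x : E) : Set E :=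
  {η | ∃ (xk ηk : ℕ → E), Tendsto xk atTop (𝓝 x) ∧ Tendsto ηk atTop (𝓝 η) ∧
    ∀ k, xk k ∈ C ∧ ηk k ∈ regularNormalCone C (xk k)}

end Cones

section Functions

variable {E : Type*} [NormedAddCommGroup E] [InnerProductSpace ℝ E]

/-- The epigraph of an extended-real-valued function. -/
def epi (h : E → EReal) : Set (L2Prod E ℝ) :=
  {p | h p.fst ≤ (p.snd : EReal)}

/-- `h` is proper: it never takes the value `-∞` and is not identically `∞`. -/
def IsProper (h : E → EReal) : Prop :=
  (∃ x, h x < ⊤) ∧ ∀ x, ⊥ < h x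

/-- Convexity of an extended-real-valued function: its epigraph is a convex set. -/
def IsConvex (h : E → EReal) : Prop :=
  Convex ℝ (epi h)

/-- The limiting subdifferential `∂h(x)`; it is empty where `h` is not finite. -/
def subdiff (h : E → EReal) (x : E) : Set E :=
  {z | h x ≠ ⊤ ∧ h x ≠ ⊥ ∧
    pair z (-1 : ℝ) ∈ limitingNormalCone (epi h) (pair x (h x).toReal)}

/-- The singular subdifferential `∂^∞ h(x)`; it is empty where `h` is not finite. -/
def singularSubdiff (h : E → EReal) (x : E) : Set E :=
  {z | h x ≠ ⊤ ∧ h x ≠ ⊥ ∧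
    pair z (0 : ℝ) ∈ limitingNormalCone (epi h) (pair x (h x).toReal)}

end Functions

section SetValued

variable {X Y : Type*} [NormedAddCommGroup X] [NormedSpace ℝ X]
  [NormedAddCommGroup Y] [NormedSpace ℝ Y]

/-- The graph of a set-valued mapping. -/
def gph {X Y : Type*} (Υ : X → Set Y) : Set (X × Y) :=
  {p | p.2 ∈ Υ p.1}

/-- The domain of a set-valued mapping. -/
def dom {X Y : Type*} (Υ : X → Set Y) : Set X :=
  {x | (Υ x).Nonempty}

/-- The limiting graphical derivative `D^#Υ(x, y)`. -/
def limitingGraphicalDeriv (Υ : X → Set Y) (x : X) (y : Y) : X → Set Y :=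
  fun d => {e | (d, e) ∈ limitingTangentCone (gph Υ) (x, y)}

/-- `Υ` is isolatedly calm at `(x, y)` with constant `κ`. -/
def IsolatedlyCalmAt (Υ : X → Set Y) (x : X) (y : Y) (κ : ℝ) : Prop :=
  ∃ V ∈ 𝓝 y, ∀ x', ∀ y' ∈ Υ x' ∩ V, ‖y' - y‖ ≤ κ * ‖x' - x‖

/-- `Υ` is isolatedly calm around `(x, y)`. -/
def IsolatedlyCalmAround (Υ : X → Set Y) (x : X) (y : Y) : Prop :=
  ∃ κ : ℝ, 0 < κ ∧ ∃ W ∈ 𝓝 (x, y), ∀ p ∈ W ∩ gph Υ, IsolatedlyCalmAt Υ p.1 p.2 κ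

/-- `κ` is a constant with which `Υ` satisfies the sequential condition in the definition of
inner calmness* in the fuzzy sense at `x` in direction `d`. -/
def FuzzyInnerCalmConst (Υ : X → Set Y) (x d : X) (κ : ℝ) : Prop :=
  0 < κ ∧ ∃ (y : Y) (dk : ℕ → X) (tk : ℕ → ℝ) (yk : ℕ → Y),
    Tendsto dk atTop (𝓝 d) ∧ (∀ k, 0 < tk k) ∧ Tendsto tk atTop (𝓝 0) ∧
    Tendsto yk atTop (𝓝 y) ∧
    ∀ k, x + tk k • dk k ∈ dom Υ ∧ yk k ∈ Υ (x + tk k • dk k) ∧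
      ‖yk k - y‖ ≤ κ * tk k * ‖dk k‖

/-- `Υ` is inner calm* in the fuzzy sense w.r.t. its domain at `x` in direction `d`. -/
def FuzzyInnerCalm (Υ : X → Set Y) (x d : X) : Prop :=
  d ∉ tangentCone (dom Υ) x ∨ ∃ κ, FuzzyInnerCalmConst Υ x d κ

open Classical in
/-- The modulus of inner calmness* in the fuzzy sense w.r.t. the domain at `x` in direction `d`
(meaningful only if `FuzzyInnerCalm Υ x d` holds). -/
def fuzzyInnerCalmModulus (Υ : X → Set Y) (x d : X) : ℝ :=
  if d ∈ tangentCone (dom Υ) x then sInf {κ | FuzzyInnerCalmConst Υ x d κ} else 0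

/-- `Υ` is locally uniformly inner calm* in the fuzzy sense w.r.t. its domain at `x` in
direction `d`. -/
def LocallyUniformlyFuzzyInnerCalm (Υ : X → Set Y) (x d : X) : Prop :=
  ∃ U ∈ 𝓝 x, ∃ N ∈ 𝓝 d, ∃ κ : ℝ, 0 < κ ∧ ∀ x' ∈ U ∩ dom Υ, ∀ d' ∈ N,
    FuzzyInnerCalm Υ x' d' ∧ fuzzyInnerCalmModulus Υ x' d' ≤ κ

end SetValued

section Model

variable {n m : ℕ}

/-- The composite function `f(x, u) = f₀(x) + g(F(x) + u)`. -/
def composite (f₀ : R n → ℝ) (F : R n → R m) (g : R m → EReal) : L2Prod (R n) (R m) → EReal :=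
  fun p => (f₀ p.fst : EReal) + g (F p.fst + p.snd)

/-- The mapping `M(v, u) = {x | v ∈ ∂ₓ f(x, u)}`, with `∂ₓ f(x, u)` the limiting subdifferential
of `f(·, u)` at `x`. -/
def mapM (f : L2Prod (R n) (R m) → EReal) : L2Prod (R n) (R m) → Set (R n) :=
  fun p => {x | p.fst ∈ subdiff (fun x' => f (pair x' p.snd)) x}

/-- The multiplier mapping `Y(v, u, x) = {y | (v, y) ∈ ∂f(x, u)}`. The argument `(v, u, x)` is
represented as `((v, u), x)`. -/
def mapY (f : L2Prod (R n) (R m) → EReal) : L2Prod (L2Prod (R n) (R m)) (R n) → Set (R m) :=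
  fun q => {y | pair q.fst.fst y ∈ subdiff f (pair q.snd q.fst.snd)}

/-- The Lagrangian `L(x, y) = f₀(x) + yᵀ F(x)`. -/
def lagrangian (f₀ : R n → ℝ) (F : R n → R m) (x : R n) (y : R m) : ℝ :=
  f₀ x + inner ℝ y (F x)

/-- The Hessian `∇²ₓₓ L(x, y)`, as a linear map. -/
def hessLagrangian (f₀ : R n → ℝ) (F : R n → R m) (x : R n) (y : R m) : R n →L[ℝ] R n :=
  fderiv ℝ (fun x' => gradient (fun x'' => lagrangian f₀ F x'' y) x') x

/-- The multiplier `y` is strongly noncritical for `x`. -/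
def StronglyNoncritical (f₀ : R n → ℝ) (F : R n → R m) (g : R m → EReal) (x : R n) (y : R m) :
    Prop :=
  ∀ (dx : R n) (dy : R m),
    hessLagrangian f₀ F x y dx + ContinuousLinearMap.adjoint (fderiv ℝ F x) dy = 0 →
    dy ∈ limitingGraphicalDeriv (subdiff g) (F x) y (fderiv ℝ F x dx) →
    dx = 0

/-- The basic qualification condition at `x` for the composite function:
`F'(x)ᵀ y = 0` and `y ∈ ∂^∞ g(F(x))` imply `y = 0`. -/
def BasicCQ (F : R n → R m) (g : R m → EReal) (x : R n) : Prop :=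
  ∀ y : R m, ContinuousLinearMap.adjoint (fderiv ℝ F x) y = 0 →
    y ∈ singularSubdiff g (F x) → y = 0

end Model

end CritMult

end

/-!
By compactness of unit spheres, a mapping is isolatedly calm around a point of its graph exactly
when its limiting graphical derivative at that point sends `0` to `{0}`.

The multiplier mapping `Y` is the solution mapping of the smooth generalized equation
`v = ∇ₓL(x, y)`, `y ∈ ∂g(F(x) + u)`, so its limiting graphical derivative is the solution mapping of
the linearized one, and strong noncriticality of a multiplier says that no `(0, 0, dx)` with
`dx ≠ 0` lifts to a limiting tangent of `gph Y` there. Up to a reordering of coordinates,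
`dom Y ⊆ gph M`, and the two sets agree near the reference point under the basic qualification
condition, which moreover bounds the multipliers locally. Limiting tangents of `gph Y` always
project to limiting tangents of `dom Y`; conversely, uniform inner calmness* lifts a limiting
tangent of `dom Y` to `gph Y`, because the base points and slopes of the lifts stay bounded.
-/

namespace CritMult

section Tangents

variable {X Z : Type*} [NormedAddCommGroup X] [NormedSpace ℝ X]
  [NormedAddCommGroup Z] [NormedSpace ℝ Z]

lemma mem_tangentCone_iff_frequently {C : Set X} {x d : X} :
    d ∈ tangentCone C x ↔ ∃ᶠ p : ℝ × X in 𝓝[>] 0 ×ˢ 𝓝 d, x + p.1 • p.2 ∈ C := by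
  constructor
  · rintro ⟨dk, tk, hdk, ht, ht0, hC⟩
    exact ((tendsto_nhdsWithin_iff.2 ⟨ht0, Eventually.of_forall ht⟩).prodMk hdk).frequently
      (Frequently.of_forall hC)
  · intro h
    have hpos : ∀ᶠ p : ℝ × X in 𝓝[>] 0 ×ˢ 𝓝 d, 0 < p.1 :=
      tendsto_fst.eventually self_mem_nhdsWithin
    obtain ⟨p, hp, hC⟩ := exists_seq_forall_of_frequently (h.and_eventually hpos)
    exact ⟨fun k => (p k).2, fun k => (p k).1, tendsto_snd.comp hp, fun k => (hC k).2,
      tendsto_nhds_of_tendsto_nhdsWithin (tendsto_fst.comp hp), fun k => (hC k).1⟩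

lemma mem_limitingTangentCone_iff_frequently {C : Set X} {x d : X} :
    d ∈ limitingTangentCone C x ↔
      ∃ᶠ p : X × X in 𝓝 (x, d), p.1 ∈ C ∧ p.2 ∈ tangentCone C p.1 := by
  constructor
  · rintro ⟨xk, dk, hxk, hdk, hk⟩
    exact (hxk.prodMk_nhds hdk).frequently (Frequently.of_forall hk)
  · intro h
    obtain ⟨p, hp, hC⟩ := exists_seq_forall_of_frequently h
    exact ⟨fun k => (p k).1, fun k => (p k).2, (continuous_fst.tendsto _).comp hp,
      (continuous_snd.tendsto _).comp hp, hC⟩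

lemma mem_closure_of_mem_limitingTangentCone {C : Set X} {x d : X}
    (hd : d ∈ limitingTangentCone C x) : x ∈ closure C := by
  obtain ⟨xk, _, hxk, _, hC⟩ := hd
  exact mem_closure_of_tendsto hxk (Eventually.of_forall fun k => (hC k).1)

lemma tendsto_add_smul (x d : X) :
    Tendsto (fun p : ℝ × X => x + p.1 • p.2) (𝓝[>] 0 ×ˢ 𝓝 d) (𝓝 x) := by
  have hcont : Tendsto (fun p : ℝ × X => x + p.1 • p.2) (𝓝 (0, d)) (𝓝 (x + (0 : ℝ) • d)) :=
    Continuous.tendsto (by fun_prop) _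
  rw [zero_smul, add_zero, nhds_prod_eq] at hcont
  exact hcont.mono_left (prod_mono_left _ nhdsWithin_le_nhds)

lemma mem_closure_of_mem_tangentCone {C : Set X} {x d : X} (hd : d ∈ tangentCone C x) :
    x ∈ closure C :=
  mem_closure_iff_frequently.2
    ((tendsto_add_smul x d).frequently (mem_tangentCone_iff_frequently.1 hd))

lemma tendsto_difference_quotient {f : X → Z} {f' : X →L[ℝ] Z} {x : X}
    (hf : HasFDerivAt f f' x) (d : X) :
    Tendsto (fun p : ℝ × X => p.1⁻¹ • (f (x + p.1 • p.2) - f x)) (𝓝[>] 0 ×ˢ 𝓝 d)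
      (𝓝 (f' d)) := by
  refine (hasFDerivWithinAt_univ.2 hf).lim ?_ (Eventually.of_forall fun _ => Set.mem_univ _) ?_
  · simpa using (tendsto_add_smul x d).sub_const x
  · refine tendsto_snd.congr' ?_
    filter_upwards [tendsto_fst.eventually self_mem_nhdsWithin] with p hp
    rw [inv_smul_smul₀ (ne_of_gt hp)]

theorem map_mem_tangentCone {C : Set X} {D : Set Z} {f : X → Z} {f' : X →L[ℝ] Z} {x d : X}
    (hf : HasFDerivAt f f' x) (hCD : ∀ᶠ x' in 𝓝[C] x, f x' ∈ D) (hd : d ∈ tangentCone C x) :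
    f' d ∈ tangentCone D (f x) := by
  rw [mem_tangentCone_iff_frequently] at hd ⊢
  refine (tendsto_fst.prodMk (tendsto_difference_quotient hf d)).frequently ?_
  have hD := (tendsto_add_smul x d).eventually (eventually_nhdsWithin_iff.1 hCD)
  refine (hd.and_eventually (hD.and (tendsto_fst.eventually self_mem_nhdsWithin))).mono ?_
  rintro p ⟨hpC, hpD, hp⟩
  simpa [smul_inv_smul₀ (ne_of_gt hp)] using hpD hpC

theorem map_mem_limitingTangentCone {C : Set X} {D : Set Z} {f : X → Z} {x d : X}
    (hf : ContDiff ℝ 1 f) (hCD : ∀ᶠ x' in 𝓝[C] x, f x' ∈ D) (hd : d ∈ limitingTangentCone C x) :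
    fderiv ℝ f x d ∈ limitingTangentCone D (f x) := by
  rw [mem_limitingTangentCone_iff_frequently] at hd ⊢
  have hcont : Continuous fun p : X × X => (f p.1, fderiv ℝ f p.1 p.2) :=
    (hf.continuous.comp continuous_fst).prodMk (hf.continuous_fderiv_apply one_ne_zero)
  refine (hcont.tendsto (x, d)).frequently ?_
  have hD := eventually_nhdsWithin_iff.1 (hCD.and (eventually_eventually_nhdsWithin.2 hCD))
  refine (hd.and_eventually ((continuous_fst.tendsto (x, d)).eventually hD)).mono ?_
  rintro p ⟨⟨hpC, hp⟩, hpD⟩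
  exact ⟨(hpD hpC).1, map_mem_tangentCone (hf.differentiable one_ne_zero _).hasFDerivAt
    (hpD hpC).2 hp⟩

lemma fderiv_eq_zero_of_mem_limitingTangentCone {C : Set X} {f : X → Z} {x d : X} {c : Z}
    (hf : ContDiff ℝ 1 f) (hC : ∀ x' ∈ C, f x' = c) (hd : d ∈ limitingTangentCone C x) :
    fderiv ℝ f x d = 0 := by
  obtain ⟨zk, ek, -, hek, hk⟩ := map_mem_limitingTangentCone (D := {c}) hf
    (eventually_nhdsWithin_of_forall hC) hd
  suffices h0 : ∀ k, ek k = 0 from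
    tendsto_nhds_unique hek (tendsto_const_nhds.congr fun k => (h0 k).symm)
  intro k
  obtain ⟨hzc, e, t, he, ht, -, hc⟩ := hk k
  refine tendsto_nhds_unique he (tendsto_const_nhds.congr fun i => ?_)
  have hci : zk k + t i • e i = zk k := (hc i).trans hzc.symm
  exact ((smul_eq_zero_iff_right (ht i).ne').1 (add_eq_left.1 hci)).symm

lemma prodMk_mem_limitingTangentCone_univ_prod {C : Set Z} {z dz : Z} (x dx : X)
    (hdz : dz ∈ limitingTangentCone C z) :
    (dx, dz) ∈ limitingTangentCone (Set.univ ×ˢ C) (x, z) := by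
  obtain ⟨zk, ek, hzk, hek, hk⟩ := hdz
  refine ⟨fun k => (x, zk k), fun k => (dx, ek k), tendsto_const_nhds.prodMk_nhds hzk,
    tendsto_const_nhds.prodMk_nhds hek, fun k => ⟨⟨trivial, (hk k).1⟩, ?_⟩⟩
  obtain ⟨e, t, he, ht, ht0, hC⟩ := (hk k).2
  exact ⟨fun i => (dx, e i), t, tendsto_const_nhds.prodMk_nhds he, ht, ht0,
    fun i => ⟨trivial, hC i⟩⟩

end Tangents

section SetValued

lemma exists_frequently_of_frequently_exists {X Y : Type*} [TopologicalSpace X]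
    [TopologicalSpace Y] {K : Set Y} (hK : IsCompact K) {x₀ : X} {P : X → Y → Prop}
    (h : ∃ᶠ x in 𝓝 x₀, ∃ y ∈ K, P x y) :
    ∃ y ∈ K, ∃ᶠ z : X × Y in 𝓝 (x₀, y), P z.1 z.2 := by
  by_contra! hcon
  refine h ((hK.eventually_forall_of_forall_eventually (P := fun x y => ¬ P x y) hcon).mono ?_)
  rintro x hx ⟨y, hy, hP⟩
  exact hx y hy hP

variable {X Y : Type*} [NormedAddCommGroup X] [NormedSpace ℝ X]
  [NormedAddCommGroup Y] {Υ : X → Set Y} {x d : X} {y : Y} {κ : ℝ}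

lemma exists_fuzzyInnerCalmConst (h : FuzzyInnerCalm Υ x d)
    (hmod : fuzzyInnerCalmModulus Υ x d ≤ κ) (hd : d ∈ tangentCone (dom Υ) x) :
    ∃ κ' ≤ κ + 1, FuzzyInnerCalmConst Υ x d κ' := by
  rw [fuzzyInnerCalmModulus, if_pos hd] at hmod
  obtain ⟨κ', hκ', hlt⟩ := exists_lt_of_csInf_lt (h.resolve_left (not_not.2 hd))
    (hmod.trans_lt (lt_add_one κ))
  exact ⟨κ', hlt.le, hκ'⟩

lemma locallyUniformlyFuzzyInnerCalm_of_notMem (hd : d ∉ limitingTangentCone (dom Υ) x) :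
    LocallyUniformlyFuzzyInnerCalm Υ x d := by
  rw [mem_limitingTangentCone_iff_frequently, not_frequently, nhds_prod_eq,
    eventually_prod_iff] at hd
  obtain ⟨U, hU, N, hN, hUN⟩ := hd
  refine ⟨{x' | U x'}, hU, {d' | N d'}, hN, 1, one_pos, fun x' hx' d' hd' => ?_⟩
  have hnotMem : d' ∉ tangentCone (dom Υ) x' := fun hmem => hUN hx'.1 hd' ⟨hx'.2, hmem⟩
  exact ⟨Or.inl hnotMem, by rw [fuzzyInnerCalmModulus, if_neg hnotMem]; exact zero_le_one⟩

variable [NormedSpace ℝ Y]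

lemma norm_snd_le_of_mem_tangentCone_gph {p : X × Y} (hcalm : IsolatedlyCalmAt Υ x y κ)
    (hp : p ∈ tangentCone (gph Υ) (x, y)) : ‖p.2‖ ≤ κ * ‖p.1‖ := by
  obtain ⟨V, hV, hle⟩ := hcalm
  obtain ⟨dk, tk, hdk, ht, ht0, hC⟩ := hp
  have hd1 := (continuous_fst.tendsto p).comp hdk
  have hd2 := (continuous_snd.tendsto p).comp hdk
  have hV' : ∀ᶠ k in atTop, y + tk k • (dk k).2 ∈ V := by
    have hlim := (ht0.smul hd2).const_add y
    rw [zero_smul, add_zero] at hlim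
    exact hlim.eventually hV
  refine le_of_tendsto_of_tendsto hd2.norm (hd1.norm.const_mul κ) ?_
  filter_upwards [hV'] with k hk
  have hle_k : ‖y + tk k • (dk k).2 - y‖ ≤ κ * ‖x + tk k • (dk k).1 - x‖ :=
    hle _ _ ⟨hC k, hk⟩
  rw [add_sub_cancel_left, add_sub_cancel_left, norm_smul, norm_smul, mul_left_comm] at hle_k
  exact le_of_mul_le_mul_left hle_k (norm_pos_iff.2 (ht k).ne')

/- If the bound failed at points of the graph tending to `(x, y)`, the displacements divided by
the norm of their second component would accumulate at a tangent direction. -/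
lemma isolatedlyCalmAt_of_forall_notMem_tangentCone [FiniteDimensional ℝ X]
    [FiniteDimensional ℝ Y] (hκ : 0 < κ)
    (h : ∀ a b, ‖a‖ ≤ κ⁻¹ → ‖b‖ = 1 → (a, b) ∉ tangentCone (gph Υ) (x, y)) :
    IsolatedlyCalmAt Υ x y κ := by
  have := FiniteDimensional.proper ℝ X
  have := FiniteDimensional.proper ℝ Y
  have hnotMem : ∀ᶠ t : ℝ in 𝓝[>] 0,
      ∀ p ∈ Metric.closedBall (0 : X) κ⁻¹ ×ˢ Metric.sphere (0 : Y) 1, (x, y) + t • p ∉ gph Υ := by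
    rw [eventually_nhdsWithin_iff]
    have hK := (isCompact_closedBall (0 : X) κ⁻¹).prod (isCompact_sphere (0 : Y) 1)
    refine (hK.eventually_forall_of_forall_eventually
      (P := fun t p => 0 < t → (x, y) + t • p ∉ gph Υ) fun p hp => ?_).mono
      fun t ht ht0 p hp => ht p hp ht0
    have hp' := mem_tangentCone_iff_frequently.not.1
      (h p.1 p.2 (mem_closedBall_zero_iff.1 hp.1) (mem_sphere_zero_iff_norm.1 hp.2))
    rw [not_frequently, ← nhdsWithin_univ p, ← nhdsWithin_prod_eq,
      eventually_nhdsWithin_iff] at hp'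
    exact hp'.mono fun q hq hq0 => hq ⟨hq0, trivial⟩
  obtain ⟨ε, hε, hball⟩ := (nhdsGT_basis (0 : ℝ)).eventually_iff.1 hnotMem
  refine ⟨Metric.ball y ε, Metric.ball_mem_nhds y hε, fun x' y' hy' => ?_⟩
  by_contra! hlt
  set t := ‖y' - y‖ with ht
  have ht0 : 0 < t := (by positivity : 0 ≤ κ * ‖x' - x‖).trans_lt hlt
  refine hball ⟨ht0, mem_ball_iff_norm.1 hy'.2⟩ (t⁻¹ • (x' - x), t⁻¹ • (y' - y)) ⟨?_, ?_⟩ ?_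
  · rw [mem_closedBall_zero_iff, norm_smul, norm_inv, Real.norm_of_nonneg ht0.le,
      inv_mul_le_iff₀ ht0, ← div_eq_mul_inv, le_div_iff₀ hκ, mul_comm]
    exact hlt.le
  · rw [mem_sphere_zero_iff_norm, norm_smul, norm_inv, Real.norm_of_nonneg ht0.le, ← ht,
      inv_mul_cancel₀ ht0.ne']
  · simpa [gph, smul_inv_smul₀ ht0.ne'] using hy'.1

theorem isolatedlyCalmAround_iff [FiniteDimensional ℝ X] [FiniteDimensional ℝ Y] :
    IsolatedlyCalmAround Υ x y ↔ ∀ e ∈ limitingGraphicalDeriv Υ x y 0, e = 0 := by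
  constructor
  · rintro ⟨κ, -, W, hW, hcalm⟩ e ⟨pk, dk, hpk, hdk, hk⟩
    have hd1 := (continuous_fst.tendsto _).comp hdk
    have hd2 := (continuous_snd.tendsto _).comp hdk
    have hle : ‖e‖ ≤ κ * ‖(0 : X)‖ := by
      refine le_of_tendsto_of_tendsto hd2.norm (hd1.norm.const_mul κ) ?_
      filter_upwards [hpk.eventually hW] with k hkW
      exact norm_snd_le_of_mem_tangentCone_gph (hcalm _ ⟨hkW, (hk k).1⟩) (hk k).2
    rwa [norm_zero, mul_zero, norm_le_zero_iff] at hle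
  · intro h
    have := FiniteDimensional.proper ℝ Y
    have hev : ∀ᶠ q : X × (X × Y) in 𝓝 (0, (x, y)), ∀ b ∈ Metric.sphere (0 : Y) 1,
        q.2 ∈ gph Υ → (q.1, b) ∉ tangentCone (gph Υ) q.2 := by
      refine (isCompact_sphere (0 : Y) 1).eventually_forall_of_forall_eventually
        (P := fun (q : X × (X × Y)) b => q.2 ∈ gph Υ → (q.1, b) ∉ tangentCone (gph Υ) q.2)
        fun b hb => ?_
      have hb0 : (0, b) ∉ limitingTangentCone (gph Υ) (x, y) := fun hmem => by
        simp [h b hmem] at hb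
      rw [mem_limitingTangentCone_iff_frequently, not_frequently] at hb0
      have hswap : Continuous fun z : (X × (X × Y)) × Y => (z.1.2, (z.1.1, z.2)) := by fun_prop
      exact ((hswap.tendsto ((0, (x, y)), b)).eventually hb0).mono fun z hz hz1 hz2 =>
        hz ⟨hz1, hz2⟩
    rw [nhds_prod_eq, eventually_prod_iff] at hev
    obtain ⟨A, hA, W, hW, hAW⟩ := hev
    obtain ⟨ε, hε, hball⟩ := Metric.eventually_nhds_iff.1 hA
    refine ⟨2 / ε, by positivity, {p | W p}, hW, fun p hp =>
      isolatedlyCalmAt_of_forall_notMem_tangentCone (by positivity) fun a b ha hb =>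
        hAW (hball ?_) hp.1 b (by simpa using hb) hp.2⟩
    rw [dist_zero_right]
    rw [inv_div] at ha
    linarith

lemma exists_mem_tangentCone_gph_of_fuzzyInnerCalmConst [FiniteDimensional ℝ Y]
    (h : FuzzyInnerCalmConst Υ x d κ) :
    ∃ y e, ‖e‖ ≤ κ * ‖d‖ ∧ (d, e) ∈ tangentCone (gph Υ) (x, y) := by
  obtain ⟨-, y, dk, tk, yk, hdk, ht, ht0, -, hk⟩ := h
  have := FiniteDimensional.proper ℝ Y
  set ek : ℕ → Y := fun k => (tk k)⁻¹ • (yk k - y) with hek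
  have hek_le : ∀ k, ‖ek k‖ ≤ κ * ‖dk k‖ := fun k => by
    rw [hek, norm_smul, norm_inv, Real.norm_of_nonneg (ht k).le, inv_mul_le_iff₀ (ht k),
      ← mul_assoc, mul_comm (tk k)]
    exact (hk k).2.2
  have hbdd : ∃ᶠ k in atTop, ek k ∈ Metric.closedBall (0 : Y) (κ * ‖d‖ + 1) := by
    refine Eventually.frequently ?_
    filter_upwards [(hdk.norm.const_mul κ).eventually_lt_const (lt_add_one _)] with k hdk_lt
    exact mem_closedBall_zero_iff.2 ((hek_le k).trans hdk_lt.le)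
  obtain ⟨e, -, φ, hφ, he⟩ := tendsto_subseq_of_frequently_bounded Metric.isBounded_closedBall hbdd
  have hdφ := hdk.comp hφ.tendsto_atTop
  refine ⟨y, e, le_of_tendsto_of_tendsto' he.norm (hdφ.norm.const_mul κ) fun k => hek_le _,
    fun k => (dk (φ k), ek (φ k)), fun k => tk (φ k), hdφ.prodMk_nhds he, fun k => ht _,
    ht0.comp hφ.tendsto_atTop, fun k => ?_⟩
  simpa [gph, hek, smul_inv_smul₀ (ht (φ k)).ne'] using (hk (φ k)).2.1

theorem exists_mem_limitingTangentCone_gph [FiniteDimensional ℝ Y] (hΥ : IsClosed (gph Υ)) {r : ℝ}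
    (hr : ∀ᶠ x' in 𝓝 x, ∀ y ∈ Υ x', ‖y‖ ≤ r) (hcalm : LocallyUniformlyFuzzyInnerCalm Υ x d)
    (hd : d ∈ limitingTangentCone (dom Υ) x) :
    ∃ y ∈ Υ x, ∃ e, (d, e) ∈ limitingTangentCone (gph Υ) (x, y) := by
  have := FiniteDimensional.proper ℝ Y
  obtain ⟨U, hU, N, hN, κ, hκ, huniform⟩ := hcalm
  set K := Metric.closedBall (0 : Y) r ×ˢ Metric.closedBall (0 : Y) ((κ + 1) * (‖d‖ + 1))
  have hlift : ∃ᶠ p : X × X in 𝓝 (x, d), ∃ q ∈ K,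
      (p.1, q.1) ∈ gph Υ ∧ (p.2, q.2) ∈ tangentCone (gph Υ) (p.1, q.1) := by
    have hnear : ∀ᶠ p : X × X in 𝓝 (x, d),
        (p.1 ∈ U ∧ ∀ y ∈ Υ p.1, ‖y‖ ≤ r) ∧ p.2 ∈ N ∧ ‖p.2‖ < ‖d‖ + 1 := by
      rw [nhds_prod_eq]
      exact (Eventually.and hU hr).prod_mk (Eventually.and hN
        (continuous_norm.continuousAt.eventually_lt continuousAt_const (lt_add_one ‖d‖)))
    refine ((mem_limitingTangentCone_iff_frequently.1 hd).and_eventually hnear).mono ?_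
    rintro ⟨x', d'⟩ ⟨⟨hx', hd'⟩, ⟨hxU, hxr⟩, hdN, hdnorm⟩
    obtain ⟨hfuzzy, hmod⟩ := huniform x' ⟨hxU, hx'⟩ d' hdN
    obtain ⟨κ', hκ', hconst⟩ := exists_fuzzyInnerCalmConst hfuzzy hmod hd'
    obtain ⟨y, e, he, hmem⟩ := exists_mem_tangentCone_gph_of_fuzzyInnerCalmConst hconst
    have hy : (x', y) ∈ gph Υ := hΥ.closure_subset (mem_closure_of_mem_tangentCone hmem)
    refine ⟨(y, e), ⟨mem_closedBall_zero_iff.2 (hxr y hy), mem_closedBall_zero_iff.2 ?_⟩, hy, hmem⟩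
    calc ‖e‖ ≤ κ' * ‖d'‖ := he
      _ ≤ (κ + 1) * (‖d‖ + 1) := by gcongr
  obtain ⟨⟨y, e⟩, -, hye⟩ := exists_frequently_of_frequently_exists
    ((isCompact_closedBall _ _).prod (isCompact_closedBall _ _)) hlift
  have hswap : Continuous fun z : (X × X) × (Y × Y) => ((z.1.1, z.2.1), (z.1.2, z.2.2)) := by
    fun_prop
  have hmem := mem_limitingTangentCone_iff_frequently.2
    ((hswap.tendsto ((x, d), (y, e))).frequently hye)
  exact ⟨y, hΥ.closure_subset (mem_closure_of_mem_limitingTangentCone hmem), e, hmem⟩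

lemma mem_limitingTangentCone_dom {e : Y} (he : e ∈ limitingGraphicalDeriv Υ x y d) :
    d ∈ limitingTangentCone (dom Υ) x := by
  have hmap := map_mem_limitingTangentCone (D := dom Υ) (contDiff_fst (𝕜 := ℝ) (E := X) (F := Y))
    (eventually_nhdsWithin_of_forall fun p hp => ⟨p.2, hp⟩) he
  rwa [fderiv_fst] at hmap

end SetValued

section NormalCones

open ContinuousLinearMap (adjoint)

variable {E H : Type*} [NormedAddCommGroup E] [InnerProductSpace ℝ E]
  [NormedAddCommGroup H] [InnerProductSpace ℝ H]

/-- The normal cone of convex analysis to `C` at `c`. The point `c` need not belong to `C`, so that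
the graph of the normal cone mapping is closed for every set `C`. -/
def convexNormalCone (C : Set H) (c : H) : Set H :=
  {l | ∀ c' ∈ C, inner ℝ l (c' - c) ≤ 0}

lemma isClosed_gph_convexNormalCone (C : Set H) : IsClosed (gph (convexNormalCone C)) := by
  have hgph : gph (convexNormalCone C) =
      ⋂ c' ∈ C, {p : H × H | inner ℝ p.2 (c' - p.1) ≤ 0} := by
    ext p
    simp [gph, convexNormalCone]
  rw [hgph]
  exact isClosed_biInter fun c' _ => isClosed_le (by fun_prop) continuous_const

lemma smul_mem_convexNormalCone {C : Set H} {c l : H} {t : ℝ} (ht : 0 ≤ t)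
    (hl : l ∈ convexNormalCone C c) : t • l ∈ convexNormalCone C c := fun c' hc' => by
  rw [real_inner_smul_left]
  exact mul_nonpos_of_nonneg_of_nonpos ht (hl c' hc')

lemma regularNormalCone_subset_limitingNormalCone {C : Set H} {c : H} (hc : c ∈ C) :
    regularNormalCone C c ⊆ limitingNormalCone C c := fun η hη =>
  ⟨fun _ => c, fun _ => η, tendsto_const_nhds, tendsto_const_nhds, fun _ => ⟨hc, hη⟩⟩

lemma convexNormalCone_subset_regularNormalCone (C : Set H) (c : H) :
    convexNormalCone C c ⊆ regularNormalCone C c := fun l hl ε hε =>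
  eventually_nhdsWithin_of_forall fun c' hc' => (hl c' hc').trans (by positivity)

lemma regularNormalCone_subset_convexNormalCone {C : Set H} (hC : Convex ℝ C) {c : H}
    (hc : c ∈ C) : regularNormalCone C c ⊆ convexNormalCone C c := by
  intro η hη c' hc'
  refine le_of_forall_pos_le_add fun ε hε => ?_
  have hδ : 0 < ε / (‖c' - c‖ + 1) := by positivity
  have hline : Tendsto (fun t : ℝ => c + t • (c' - c)) (𝓝[>] 0) (𝓝[C] c) := by
    refine tendsto_nhdsWithin_iff.2 ⟨tendsto_nhdsWithin_of_tendsto_nhds ?_, ?_⟩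
    · have hcont : Continuous fun t : ℝ => c + t • (c' - c) := by fun_prop
      simpa using hcont.tendsto 0
    · filter_upwards [Ioc_mem_nhdsGT zero_lt_one] with t ht
      exact hC.add_smul_sub_mem hc hc' ⟨ht.1.le, ht.2⟩
  obtain ⟨t, hle, ht⟩ := ((hline.eventually (hη _ hδ)).and self_mem_nhdsWithin).exists
  rw [add_sub_cancel_left, real_inner_smul_right, norm_smul, Real.norm_of_nonneg (le_of_lt ht),
    mul_left_comm] at hle
  calc inner ℝ η (c' - c) ≤ ε / (‖c' - c‖ + 1) * ‖c' - c‖ := le_of_mul_le_mul_left hle ht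
    _ ≤ ε / (‖c' - c‖ + 1) * (‖c' - c‖ + 1) := by gcongr; linarith
    _ = 0 + ε := by field_simp; ring

theorem limitingNormalCone_eq_convexNormalCone {C : Set H} (hC : Convex ℝ C) {c : H}
    (hc : c ∈ C) : limitingNormalCone C c = convexNormalCone C c := by
  refine Set.Subset.antisymm ?_ ((convexNormalCone_subset_regularNormalCone C c).trans
    (regularNormalCone_subset_limitingNormalCone hc))
  rintro η ⟨ck, ηk, hck, hηk, hk⟩
  exact (isClosed_gph_convexNormalCone C).mem_of_tendsto (hck.prodMk_nhds hηk)
    (Eventually.of_forall fun k => regularNormalCone_subset_convexNormalCone hC (hk k).1 (hk k).2)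

theorem exists_eventually_norm_le_of_convexNormalCone {V : Type*} [NormedAddCommGroup V]
    [NormedSpace ℝ V] [FiniteDimensional ℝ H] {C : Set H} {B₀ : H →L[ℝ] V} {c₀ : H}
    (hB₀ : ∀ l ∈ convexNormalCone C c₀, B₀ l = 0 → l = 0) :
    ∃ κ, ∀ᶠ p : (H →L[ℝ] V) × H in 𝓝 (B₀, c₀), ∀ l ∈ convexNormalCone C p.2,
      ‖l‖ ≤ κ * ‖p.1 l‖ := by
  have hsphere : ∀ᶠ q : ℝ × ((H →L[ℝ] V) × H) in 𝓝 (0, (B₀, c₀)),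
      ∀ l ∈ Metric.sphere (0 : H) 1, l ∈ convexNormalCone C q.2.2 → q.1 < ‖q.2.1 l‖ := by
    refine (isCompact_sphere (0 : H) 1).eventually_forall_of_forall_eventually
      (P := fun (q : ℝ × ((H →L[ℝ] V) × H)) l => l ∈ convexNormalCone C q.2.2 → q.1 < ‖q.2.1 l‖)
      fun l hl => ?_
    by_cases hlN : l ∈ convexNormalCone C c₀
    · have hpos : 0 < ‖B₀ l‖ := norm_pos_iff.2 fun h0 => by simp [hB₀ l hlN h0] at hl
      have hopen : IsOpen {z : (ℝ × ((H →L[ℝ] V) × H)) × H | z.1.1 < ‖z.1.2.1 z.2‖} :=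
        isOpen_lt (by fun_prop) (by fun_prop)
      have hnear : ∀ᶠ z : (ℝ × ((H →L[ℝ] V) × H)) × H in 𝓝 ((0, (B₀, c₀)), l),
          z.1.1 < ‖z.1.2.1 z.2‖ := hopen.mem_nhds hpos
      exact hnear.mono fun z hz _ => hz
    · have hcont : Continuous fun z : (ℝ × ((H →L[ℝ] V) × H)) × H => (z.1.2.2, z.2) := by fun_prop
      have hfar := (hcont.tendsto ((0, (B₀, c₀)), l)).eventually
        ((isClosed_gph_convexNormalCone C).isOpen_compl.mem_nhds hlN)
      exact hfar.mono fun z hz hzN => (hz hzN).elim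
  rw [nhds_prod_eq] at hsphere
  obtain ⟨δ, hδ, hδ0⟩ := ((hsphere.curry.filter_mono nhdsWithin_le_nhds).and
    (self_mem_nhdsWithin (s := Set.Ioi 0))).exists
  refine ⟨δ⁻¹, hδ.mono fun p hp l hl => ?_⟩
  rcases eq_or_ne l 0 with rfl | hl0
  · simp
  have hnorm : 0 < ‖l‖ := norm_pos_iff.2 hl0
  have hunit : ‖l‖⁻¹ • l ∈ Metric.sphere (0 : H) 1 := by
    rw [mem_sphere_zero_iff_norm, norm_smul, norm_inv, norm_norm, inv_mul_cancel₀ hnorm.ne']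
  have hlt := hp _ hunit (smul_mem_convexNormalCone (by positivity) hl)
  rw [map_smul, norm_smul, norm_inv, norm_norm, lt_inv_mul_iff₀ hnorm] at hlt
  rw [le_inv_mul_iff₀ hδ0, mul_comm]
  exact hlt.le

lemma exists_isMinOn_add_natCast_mul {X : Type*} [TopologicalSpace X] {K U : Set X} {q δ : X → ℝ}
    {p : X} (hK : IsCompact K) (hU : IsOpen U) (hq : Continuous q) (hδ : Continuous δ)
    (hδ0 : ∀ x, 0 ≤ δ x) (hp : p ∈ K) (hδp : δ p = 0)
    (hsep : ∀ x ∈ K \ U, δ x = 0 → q p < q x) :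
    ∃ n : ℕ, ∃ x ∈ K ∩ U, IsMinOn (fun y => q y + n * δ y) K x := by
  have hmono : Monotone fun n : ℕ => {x | q p < q x + n * δ x} := fun i j hij x hx =>
    lt_of_lt_of_le (b := q x + i * δ x) hx (by have := hδ0 x; gcongr)
  have hcover : K \ U ⊆ ⋃ n : ℕ, {x | q p < q x + n * δ x} := fun x hx => by
    rw [Set.mem_iUnion]
    rcases (hδ0 x).eq_or_lt with h0 | hpos
    · exact ⟨0, by simpa using hsep x hx h0.symm⟩
    · obtain ⟨n, hn⟩ := exists_nat_gt ((q p - q x) / δ x)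
      rw [div_lt_iff₀ hpos] at hn
      exact ⟨n, show q p < q x + n * δ x by linarith⟩
  obtain ⟨n, hn⟩ := (hK.diff hU).elim_directed_cover _
    (fun n => isOpen_lt continuous_const (by fun_prop)) hcover hmono.directed_le
  obtain ⟨x, hxK, hmin⟩ := hK.exists_isMinOn ⟨p, hp⟩
    (Continuous.continuousOn (f := fun y => q y + n * δ y) (by fun_prop))
  refine ⟨n, x, ⟨hxK, by_contra fun hxU => ?_⟩, hmin⟩
  have hle : q x + n * δ x ≤ q p := by simpa [hδp] using isMinOn_iff.1 hmin p hp
  exact absurd (hn ⟨hxK, hxU⟩) hle.not_gt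

lemma norm_le_of_hasFDerivAt_of_eventually_le {V : Type*} [NormedAddCommGroup V] [NormedSpace ℝ V]
    {θ : V → ℝ} {θ' : V →L[ℝ] ℝ} {p : V} {ε : ℝ} (hε : 0 ≤ ε) (hθ : HasFDerivAt θ θ' p)
    (hmin : ∀ᶠ x in 𝓝 p, θ p ≤ θ x + ε * ‖x - p‖) : ‖θ'‖ ≤ ε := by
  have hlower : ∀ w, -(ε * ‖w‖) ≤ θ' w := fun w => by
    refine ge_of_tendsto (hθ.lim_real w) ?_
    have hline : Tendsto (fun c : ℝ => p + c⁻¹ • w) atTop (𝓝 p) := by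
      simpa using ((tendsto_inv_atTop_zero (𝕜 := ℝ)).smul_const w).const_add p
    filter_upwards [hline.eventually hmin, eventually_gt_atTop 0] with c hc hc0
    rw [add_sub_cancel_left, norm_smul, norm_inv, Real.norm_of_nonneg hc0.le] at hc
    have hscale : c * (ε * (c⁻¹ * ‖w‖)) = ε * ‖w‖ := by field_simp
    have hmul := mul_le_mul_of_nonneg_left hc hc0.le
    rw [smul_eq_mul]
    linarith
  refine θ'.opNorm_le_bound hε fun w => abs_le.2 ⟨hlower w, ?_⟩
  have hneg := hlower (-w)
  rw [map_neg, norm_neg] at hneg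
  linarith

lemma exists_infDist_eq_and_sub_mem_convexNormalCone [CompleteSpace H] {C : Set H}
    (hC : IsClosed C) (hconv : Convex ℝ C) (hne : C.Nonempty) (z : H) :
    ∃ c ∈ C, Metric.infDist z C = ‖z - c‖ ∧ z - c ∈ convexNormalCone C c := by
  obtain ⟨c, hc, hmin⟩ := exists_norm_eq_iInf_of_complete_convex hne hC.isComplete hconv z
  refine ⟨c, hc, ?_, (norm_eq_iInf_iff_real_inner_le_zero hconv hc).1 hmin⟩
  rw [hmin, Metric.infDist_eq_iInf]
  simp only [dist_eq_norm]

lemma exists_closedBall_inner_lt_of_mem_regularNormalCone {D : Set E} {p η : E}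
    (hη : η ∈ regularNormalCone D p) {ε : ℝ} (hε : 0 < ε) :
    ∃ r > 0, ∀ x ∈ Metric.closedBall p r, x ∈ D → x ≠ p → inner ℝ η (x - p) < ε * ‖x - p‖ := by
  obtain ⟨r, hr, hball⟩ :=
    Metric.nhds_basis_closedBall.eventually_iff.1 (eventually_nhdsWithin_iff.1 (hη _ (half_pos hε)))
  refine ⟨r, hr, fun x hx hxD hxp => (hball hx hxD).trans_lt ?_⟩
  have := norm_sub_pos_iff.2 hxp
  gcongr
  exact half_lt_self hε

theorem adjoint_mem_regularNormalCone_preimage [CompleteSpace E] [CompleteSpace H]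
    {G : E → H} {p : E} (hG : DifferentiableAt ℝ G p) {C : Set H} {l : H}
    (hl : l ∈ convexNormalCone C (G p)) :
    adjoint (fderiv ℝ G p) l ∈ regularNormalCone (G ⁻¹' C) p := by
  intro ε hε
  have hsmall := hG.hasFDerivAt.isLittleO.def (c := ε / (‖l‖ + 1)) (by positivity)
  filter_upwards [self_mem_nhdsWithin, mem_nhdsWithin_of_mem_nhds hsmall] with x hxC hx
  set w := G x - G p - fderiv ℝ G p (x - p) with hw
  have hsplit : fderiv ℝ G p (x - p) = G x - G p - w := by rw [hw, sub_sub_cancel]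
  calc inner ℝ (adjoint (fderiv ℝ G p) l) (x - p)
      = inner ℝ l (G x - G p) - inner ℝ l w := by
        rw [ContinuousLinearMap.adjoint_inner_left, hsplit, inner_sub_right]
    _ ≤ ‖l‖ * ‖w‖ := by
        linarith [hl _ hxC, neg_le_of_abs_le (abs_real_inner_le_norm l w)]
    _ ≤ (‖l‖ + 1) * (ε / (‖l‖ + 1) * ‖x - p‖) := by gcongr; linarith
    _ = ε * ‖x - p‖ := by field_simp

lemma norm_adjoint_fderiv_sub_le_of_isMinOn [CompleteSpace E] [CompleteSpace H] {G : E → H}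
    {C : Set H} {K : Set E} {p p' η : E} {c : H} {a ε : ℝ} (hG : DifferentiableAt ℝ G p')
    (hK : K ∈ 𝓝 p') (hc : c ∈ C) (hdist : Metric.infDist (G p') C = ‖G p' - c‖) (ha : 0 ≤ a)
    (hε : 0 ≤ ε) (hmin : IsMinOn
      (fun x => ε * ‖x - p‖ - inner ℝ η (x - p) + a * Metric.infDist (G x) C ^ 2) K p') :
    ‖adjoint (fderiv ℝ G p') ((2 * a) • (G p' - c)) - η‖ ≤ ε := by
  have hderiv : HasFDerivAt (fun x => a * ‖G x - c‖ ^ 2 - inner ℝ η x)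
      (innerSL ℝ (adjoint (fderiv ℝ G p') ((2 * a) • (G p' - c)) - η)) p' := by
    refine (((hG.hasFDerivAt.sub_const c).norm_sq.const_mul a).sub
      (innerSL ℝ η).hasFDerivAt).congr_fderiv ?_
    ext w
    simp [ContinuousLinearMap.adjoint_inner_left]
    ring
  rw [← innerSL_apply_norm ℝ]
  refine norm_le_of_hasFDerivAt_of_eventually_le hε hderiv ?_
  filter_upwards [hK] with x hx
  have hle := isMinOn_iff.1 hmin x hx
  have hinf : a * Metric.infDist (G x) C ^ 2 ≤ a * ‖G x - c‖ ^ 2 := by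
    rw [← dist_eq_norm]
    gcongr
    exacts [Metric.infDist_nonneg, Metric.infDist_le_dist_of_mem hc]
  have htri : ε * ‖x - p‖ ≤ ε * (‖x - p'‖ + ‖p' - p‖) := by
    gcongr
    exact norm_sub_le_norm_sub_add_norm_sub _ _ _
  simp only [hdist, inner_sub_right] at hle
  linarith

variable [FiniteDimensional ℝ E]

/- The point `p'` minimizes `ε‖x - p‖ - ⟪η, x - p⟫ + n dist(G x, C)²` near `p` for large `n`, and
`c'` is the projection of `G p'` onto `C`. -/
theorem exists_convexNormal_near_of_mem_regularNormalCone [CompleteSpace H] {G : E → H}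
    (hG : Differentiable ℝ G) {C : Set H} (hC : IsClosed C) (hconv : Convex ℝ C) {p η : E}
    (hp : G p ∈ C) (hη : η ∈ regularNormalCone (G ⁻¹' C) p) {ε : ℝ} (hε : 0 < ε) :
    ∃ p' : E, ∃ c' l : H, ‖p' - p‖ < ε ∧ ‖c' - G p‖ < ε ∧ l ∈ convexNormalCone C c' ∧
      ‖adjoint (fderiv ℝ G p') l - η‖ ≤ ε := by
  have hne : C.Nonempty := ⟨_, hp⟩
  have hGc : Continuous G := hG.continuous
  obtain ⟨r, hr, hball⟩ := exists_closedBall_inner_lt_of_mem_regularNormalCone hη hε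
  let U : Set E := {x | ‖x - p‖ < r} ∩ {x | ‖x - p‖ < ε} ∩ {x | 2 * ‖G x - G p‖ < ε}
  have hU : IsOpen U := ((isOpen_lt (by fun_prop) (by fun_prop)).inter
    (isOpen_lt (by fun_prop) (by fun_prop))).inter (isOpen_lt (by fun_prop) (by fun_prop))
  have hsep : ∀ x ∈ Metric.closedBall p r \ U, Metric.infDist (G x) C ^ 2 = 0 →
      ε * ‖p - p‖ - inner ℝ η (p - p) < ε * ‖x - p‖ - inner ℝ η (x - p) := by
    rintro x ⟨hxr, hxU⟩ hx0
    have hxC : G x ∈ C := (hC.mem_iff_infDist_zero hne).2 (sq_eq_zero_iff.1 hx0)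
    have hxp : x ≠ p := fun h => hxU (by simp [U, h, hr, hε])
    simpa using hball x hxr hxC hxp
  obtain ⟨n, p', ⟨-, ⟨hp'r, hp'ε⟩, hGp'⟩, hmin⟩ := exists_isMinOn_add_natCast_mul
    (q := fun x => ε * ‖x - p‖ - inner ℝ η (x - p)) (δ := fun x => Metric.infDist (G x) C ^ 2)
    (isCompact_closedBall p r) hU (by fun_prop)
    (((Metric.continuous_infDist_pt C).comp hGc).pow 2) (fun x => sq_nonneg _)
    (Metric.mem_closedBall_self hr.le) (by simp [Metric.infDist_zero_of_mem hp]) hsep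
  obtain ⟨c, hcC, hcd, hcN⟩ := exists_infDist_eq_and_sub_mem_convexNormalCone hC hconv hne (G p')
  refine ⟨p', c, (2 * n : ℝ) • (G p' - c), hp'ε, ?_, smul_mem_convexNormalCone (by positivity) hcN,
    norm_adjoint_fderiv_sub_le_of_isMinOn (hG p')
      (Metric.closedBall_mem_nhds_of_mem (mem_ball_iff_norm.2 hp'r)) hcC hcd n.cast_nonneg hε.le
      hmin⟩
  have hle : ‖G p' - c‖ ≤ ‖G p' - G p‖ := by
    rw [← hcd, ← dist_eq_norm]
    exact Metric.infDist_le_dist_of_mem hp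
  calc ‖c - G p‖ ≤ ‖c - G p'‖ + ‖G p' - G p‖ := norm_sub_le_norm_sub_add_norm_sub _ _ _
    _ ≤ 2 * ‖G p' - G p‖ := by rw [norm_sub_rev]; linarith
    _ < ε := hGp'

theorem exists_mem_convexNormalCone_of_mem_limitingNormalCone_preimage [FiniteDimensional ℝ H]
    {G : E → H} (hG : ContDiff ℝ 1 G) {C : Set H} (hC : IsClosed C) (hconv : Convex ℝ C) {p η : E}
    (hqual : ∀ l ∈ convexNormalCone C (G p), adjoint (fderiv ℝ G p) l = 0 → l = 0)
    (hη : η ∈ limitingNormalCone (G ⁻¹' C) p) :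
    ∃ l ∈ convexNormalCone C (G p), adjoint (fderiv ℝ G p) l = η := by
  obtain ⟨pk, ηk, hpk, hηk, hk⟩ := hη
  choose p' c' l hp' hc' hl hres using fun k : ℕ =>
    exists_convexNormal_near_of_mem_regularNormalCone (hG.differentiable one_ne_zero) hC hconv
      (hk k).1 (hk k).2 (Nat.one_div_pos_of_nat (α := ℝ) (n := k))
  have hε : Tendsto (fun k : ℕ => 1 / ((k : ℝ) + 1)) atTop (𝓝 0) :=
    tendsto_one_div_add_atTop_nhds_zero_nat
  have hp'lim : Tendsto p' atTop (𝓝 p) := by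
    simpa using (squeeze_zero_norm (fun k => (hp' k).le) hε).add hpk
  have hc'lim : Tendsto c' atTop (𝓝 (G p)) := by
    simpa using (squeeze_zero_norm (fun k => (hc' k).le) hε).add
      ((hG.continuous.tendsto p).comp hpk)
  have hDlim : Tendsto (fun k => adjoint (fderiv ℝ G (p' k))) atTop
      (𝓝 (adjoint (fderiv ℝ G p))) :=
    ((adjoint.continuous.comp (hG.continuous_fderiv one_ne_zero)).tendsto p).comp hp'lim
  have hDllim : Tendsto (fun k => adjoint (fderiv ℝ G (p' k)) (l k)) atTop (𝓝 η) := by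
    simpa using (squeeze_zero_norm hres hε).add hηk
  obtain ⟨κ, hκ⟩ := exists_eventually_norm_le_of_convexNormalCone hqual
  obtain ⟨b, hb⟩ := hDllim.norm.isBoundedUnder_le
  have hbounded : ∀ᶠ k in atTop, l k ∈ Metric.closedBall 0 (|κ| * b) := by
    filter_upwards [(hDlim.prodMk_nhds hc'lim).eventually hκ, eventually_map.1 hb] with k hk hbk
    rw [mem_closedBall_zero_iff]
    exact (hk _ (hl k)).trans (mul_le_mul (le_abs_self κ) hbk (norm_nonneg _) (abs_nonneg κ))
  obtain ⟨l₀, -, φ, hφ, hlφ⟩ :=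
    tendsto_subseq_of_frequently_bounded Metric.isBounded_closedBall hbounded.frequently
  have hDlφ : Tendsto (fun k => adjoint (fderiv ℝ G (p' (φ k))) (l (φ k))) atTop
      (𝓝 (adjoint (fderiv ℝ G p) l₀)) :=
    ((by fun_prop : Continuous fun z : (H →L[ℝ] E) × H => z.1 z.2).tendsto _).comp
      ((hDlim.comp hφ.tendsto_atTop).prodMk_nhds hlφ)
  exact ⟨l₀, (isClosed_gph_convexNormalCone C).mem_of_tendsto
    ((hc'lim.comp hφ.tendsto_atTop).prodMk_nhds hlφ) (Eventually.of_forall fun k => hl _),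
    tendsto_nhds_unique hDlφ (hDllim.comp hφ.tendsto_atTop)⟩

end NormalCones

section Subgradients

open ContinuousLinearMap (adjoint)

lemma coe_add_le_coe_iff {a c : ℝ} {b : EReal} :
    (a : EReal) + b ≤ c ↔ b ≤ ((c - a : ℝ) : EReal) := by
  rw [EReal.coe_sub, EReal.le_sub_iff_add_le (by simp) (by simp), add_comm]

lemma coe_add_ne_bot {a : ℝ} {b : EReal} : (a : EReal) + b ≠ ⊥ ↔ b ≠ ⊥ := by
  simp [EReal.add_eq_bot_iff]

lemma coe_add_ne_top {a : ℝ} {b : EReal} : (a : EReal) + b ≠ ⊤ ↔ b ≠ ⊤ := by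
  rw [add_comm, EReal.add_ne_top_iff_ne_top_left (EReal.coe_ne_bot a) (EReal.coe_ne_top a)]

variable {E H : Type*} {φ₀ : E → ℝ} {Φ : E → H} {g : H → EReal}

lemma pair_toReal_mem_epi {z : H} (htop : g z ≠ ⊤) (hbot : g z ≠ ⊥) :
    pair z (g z).toReal ∈ epi g :=
  (EReal.coe_toReal htop hbot).ge

lemma IsProper.ne_bot (hg : IsProper g) (z : H) : g z ≠ ⊥ := (hg.2 z).ne'

lemma IsProper.nonempty_epi (hg : IsProper g) : (epi g).Nonempty :=
  hg.1.elim fun z hz => ⟨_, pair_toReal_mem_epi hz.ne (hg.ne_bot z)⟩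

/-- The map under which the epigraph of `φ₀ + g ∘ Φ` is the preimage of the epigraph of `g`. -/
def epiMap (φ₀ : E → ℝ) (Φ : E → H) : L2Prod E ℝ → L2Prod H ℝ :=
  fun p => pair (Φ p.fst) (p.snd - φ₀ p.fst)

lemma epi_add_comp : epi (fun e => (φ₀ e : EReal) + g (Φ e)) = epiMap φ₀ Φ ⁻¹' epi g :=
  Set.ext fun _ => coe_add_le_coe_iff

lemma epiMap_pair_toReal {e : E} (htop : g (Φ e) ≠ ⊤) (hbot : g (Φ e) ≠ ⊥) :
    epiMap φ₀ Φ (pair e ((φ₀ e : EReal) + g (Φ e)).toReal) = pair (Φ e) (g (Φ e)).toReal := by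
  rw [EReal.toReal_add (EReal.coe_ne_top _) (EReal.coe_ne_bot _) htop hbot, EReal.toReal_coe]
  simp [epiMap]

variable [NormedAddCommGroup E] [NormedAddCommGroup H]

lemma isClosed_epi (hg : LowerSemicontinuous g) : IsClosed (epi g) :=
  hg.isClosed_epigraph.preimage (f := fun p : L2Prod H ℝ => (p.fst, (p.snd : EReal)))
    ((WithLp.continuous_fst 2 H ℝ).prodMk (continuous_coe_real_ereal.comp
      (WithLp.continuous_snd 2 H ℝ)))

variable [InnerProductSpace ℝ E] [InnerProductSpace ℝ H]

lemma inner_l2Prod (p q : L2Prod H ℝ) : inner ℝ p q = inner ℝ p.fst q.fst + p.snd * q.snd := by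
  simp [WithLp.prod_inner_apply, mul_comm]

lemma mem_subdiff_iff (hconv : IsConvex g) {z y : H} : y ∈ subdiff g z ↔
    g z ≠ ⊤ ∧ g z ≠ ⊥ ∧ pair y (-1) ∈ convexNormalCone (epi g) (pair z (g z).toReal) :=
  and_congr_right fun htop => and_congr_right fun hbot => by
    rw [limitingNormalCone_eq_convexNormalCone hconv (pair_toReal_mem_epi htop hbot)]

lemma pair_neg_one_mem_convexNormalCone_iff {C : Set (L2Prod H ℝ)} {c : L2Prod H ℝ} {y : H} :
    pair y (-1) ∈ convexNormalCone C c ↔ ∀ p ∈ C, c.snd ≤ p.snd - inner ℝ y (p.fst - c.fst) := by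
  refine forall₂_congr fun p _ => ?_
  simp only [inner_l2Prod, WithLp.toLp_fst, WithLp.toLp_snd, WithLp.sub_fst, WithLp.sub_snd]
  constructor <;> intro h <;> linarith

lemma mem_subdiff_iff_forall_le (hg : IsProper g) (hconv : IsConvex g) {z y : H} :
    y ∈ subdiff g z ↔ ∀ p ∈ epi g, g z ≤ ((p.snd - inner ℝ y (p.fst - z) : ℝ) : EReal) := by
  rw [mem_subdiff_iff hconv, pair_neg_one_mem_convexNormalCone_iff]
  constructor
  · rintro ⟨htop, hbot, hN⟩ p hp
    rw [← EReal.coe_toReal htop hbot]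
    exact EReal.coe_le_coe_iff.2 (hN p hp)
  · intro h
    obtain ⟨p, hp⟩ := hg.nonempty_epi
    have htop : g z ≠ ⊤ := ne_top_of_le_ne_top (EReal.coe_ne_top _) (h p hp)
    refine ⟨htop, hg.ne_bot z, fun p hp => EReal.coe_le_coe_iff.1 ?_⟩
    rw [WithLp.toLp_snd, EReal.coe_toReal htop (hg.ne_bot z)]
    exact h p hp

lemma isClosed_gph_subdiff (hg : IsProper g) (hlsc : LowerSemicontinuous g)
    (hconv : IsConvex g) : IsClosed (gph (subdiff g)) := by
  have hgph : gph (subdiff g) =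
      ⋂ p ∈ epi g, (fun q : H × H => pair q.1 (p.snd - inner ℝ q.2 (p.fst - q.1))) ⁻¹' epi g := by
    ext q
    simp only [Set.mem_iInter]
    exact mem_subdiff_iff_forall_le hg hconv
  rw [hgph]
  exact isClosed_biInter fun p _ => (isClosed_epi hlsc).preimage
    ((WithLp.prod_continuous_toLp 2 H ℝ).comp (by fun_prop))

lemma pair_neg_one_mem_convexNormalCone_of_mem_subdiff (hconv : IsConvex g) {z y : H} {α : ℝ}
    (hy : y ∈ subdiff g z) (hα : (α : EReal) ≤ g z) :
    pair y (-1) ∈ convexNormalCone (epi g) (pair z α) := by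
  obtain ⟨htop, hbot, hN⟩ := (mem_subdiff_iff hconv).1 hy
  rw [← EReal.coe_toReal htop hbot, EReal.coe_le_coe_iff] at hα
  rw [pair_neg_one_mem_convexNormalCone_iff] at hN ⊢
  exact fun p hp => hα.trans (hN p hp)

lemma fst_mem_convexNormalCone_of_snd_eq_zero {c l : L2Prod H ℝ}
    (hl : l ∈ convexNormalCone (epi g) c) (hsnd : l.snd = 0) :
    l.fst ∈ convexNormalCone {z | g z < ⊤} c.fst := by
  intro z hz
  obtain ⟨a, ha, -⟩ := EReal.lt_iff_exists_real_btwn.1 hz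
  simpa [inner_l2Prod, hsnd] using hl (pair z a) ha.le

lemma pair_zero_mem_convexNormalCone {z y : H} (α : ℝ)
    (hy : y ∈ convexNormalCone {z | g z < ⊤} z) :
    pair y 0 ∈ convexNormalCone (epi g) (pair z α) := fun p hp => by
  simpa [inner_l2Prod] using hy p.fst (lt_of_le_of_lt hp (EReal.coe_lt_top _))

lemma convexNormalCone_dom_subset_singularSubdiff {z : H} (htop : g z ≠ ⊤) (hbot : g z ≠ ⊥) :
    convexNormalCone {z | g z < ⊤} z ⊆ singularSubdiff g z := fun _ hy =>
  ⟨htop, hbot, regularNormalCone_subset_limitingNormalCone (pair_toReal_mem_epi htop hbot)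
    (convexNormalCone_subset_regularNormalCone _ _ (pair_zero_mem_convexNormalCone _ hy))⟩

lemma contDiff_epiMap (hφ₀ : ContDiff ℝ 1 φ₀) (hΦ : ContDiff ℝ 1 Φ) :
    ContDiff ℝ 1 (epiMap φ₀ Φ) :=
  (WithLp.prodContinuousLinearEquiv 2 ℝ H ℝ).symm.contDiff.comp
    ((hΦ.comp (WithLp.fstL 2 ℝ E ℝ).contDiff).prodMk
      ((WithLp.sndL 2 ℝ E ℝ).contDiff.sub (hφ₀.comp (WithLp.fstL 2 ℝ E ℝ).contDiff)))

lemma hasFDerivAt_epiMap {φ₀' : E →L[ℝ] ℝ} {Φ' : E →L[ℝ] H} {p : L2Prod E ℝ}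
    (hφ₀ : HasFDerivAt φ₀ φ₀' p.fst) (hΦ : HasFDerivAt Φ Φ' p.fst) :
    HasFDerivAt (epiMap φ₀ Φ) ((WithLp.prodContinuousLinearEquiv 2 ℝ H ℝ).symm.toContinuousLinearMap
      ∘L (Φ' ∘L WithLp.fstL 2 ℝ E ℝ).prod (WithLp.sndL 2 ℝ E ℝ - φ₀' ∘L WithLp.fstL 2 ℝ E ℝ)) p :=
  (WithLp.prodContinuousLinearEquiv 2 ℝ H ℝ).symm.hasFDerivAt.comp p
    ((hΦ.comp p (WithLp.fstL 2 ℝ E ℝ).hasFDerivAt).prodMk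
      ((WithLp.sndL 2 ℝ E ℝ).hasFDerivAt.sub (hφ₀.comp p (WithLp.fstL 2 ℝ E ℝ).hasFDerivAt)))

variable [CompleteSpace E] [CompleteSpace H]

lemma adjoint_fderiv_epiMap {p : L2Prod E ℝ} (hφ₀ : DifferentiableAt ℝ φ₀ p.fst)
    (hΦ : DifferentiableAt ℝ Φ p.fst) (l : L2Prod H ℝ) :
    adjoint (fderiv ℝ (epiMap φ₀ Φ) p) l =
      pair (adjoint (fderiv ℝ Φ p.fst) l.fst - l.snd • gradient φ₀ p.fst) l.snd := by
  refine ext_inner_right ℝ fun w => ?_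
  rw [ContinuousLinearMap.adjoint_inner_left,
    (hasFDerivAt_epiMap hφ₀.hasFDerivAt hΦ.hasFDerivAt).fderiv]
  simp [inner_sub_left, real_inner_smul_left, ContinuousLinearMap.adjoint_inner_left]
  ring

theorem gradient_add_adjoint_mem_subdiff (hconv : IsConvex g) {e : E}
    (hφ₀ : DifferentiableAt ℝ φ₀ e) (hΦ : DifferentiableAt ℝ Φ e) {y : H}
    (hy : y ∈ subdiff g (Φ e)) :
    gradient φ₀ e + adjoint (fderiv ℝ Φ e) y ∈ subdiff (fun e => (φ₀ e : EReal) + g (Φ e)) e := by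
  obtain ⟨htop, hbot, hN⟩ := (mem_subdiff_iff hconv).1 hy
  have htop' := (coe_add_ne_top (a := φ₀ e)).2 htop
  have hbot' := (coe_add_ne_bot (a := φ₀ e)).2 hbot
  refine ⟨htop', hbot', regularNormalCone_subset_limitingNormalCone
    (pair_toReal_mem_epi (g := fun e => (φ₀ e : EReal) + g (Φ e)) htop' hbot') ?_⟩
  rw [← epiMap_pair_toReal (φ₀ := φ₀) htop hbot] at hN
  have hadj := adjoint_mem_regularNormalCone_preimage
    (hasFDerivAt_epiMap (p := pair e _) hφ₀.hasFDerivAt hΦ.hasFDerivAt).differentiableAt hN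
  rw [adjoint_fderiv_epiMap (p := pair e _) hφ₀ hΦ, ← epi_add_comp] at hadj
  simpa [add_comm] using hadj

/-- The qualification condition `N_{dom g}(z) ∩ ker Aᵀ = {0}` on the convex function `g` at `z`,
where `A` is the derivative of the inner map of a composition with `g`. -/
def IsQualified (g : H → EReal) (z : H) (A : E →L[ℝ] H) : Prop :=
  ∀ y ∈ convexNormalCone {z | g z < ⊤} z, adjoint A y = 0 → y = 0

lemma IsQualified.eq_zero_of_mem_convexNormalCone_epi {c l : L2Prod H ℝ} {A : E →L[ℝ] H}
    (hqual : IsQualified g c.fst A) (hl : l ∈ convexNormalCone (epi g) c)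
    (hfst : adjoint A l.fst = 0) (hsnd : l.snd = 0) : l = 0 := by
  have hzero := hqual _ (fst_mem_convexNormalCone_of_snd_eq_zero hl hsnd) hfst
  exact (WithLp.ofLp_injective 2) (Prod.ext hzero hsnd)

lemma IsQualified.eventually [FiniteDimensional ℝ H] {z₀ : H} {A₀ : E →L[ℝ] H}
    (hqual : IsQualified g z₀ A₀) :
    ∀ᶠ p : (E →L[ℝ] H) × H in 𝓝 (A₀, z₀), IsQualified g p.2 p.1 := by
  obtain ⟨κ, hκ⟩ := exists_eventually_norm_le_of_convexNormalCone hqual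
  have hadj : Tendsto (fun p : (E →L[ℝ] H) × H => (adjoint p.1, p.2)) (𝓝 (A₀, z₀))
      (𝓝 (adjoint A₀, z₀)) :=
    ((adjoint.continuous.comp continuous_fst).prodMk continuous_snd).tendsto (A₀, z₀)
  filter_upwards [hadj.eventually hκ] with p hp y hy h0
  simpa [h0] using hp y hy

theorem IsQualified.exists_eventually_norm_le_of_mem_subdiff [FiniteDimensional ℝ H]
    (hlsc : LowerSemicontinuous g) (hconv : IsConvex g) {z₀ : H} {A₀ : E →L[ℝ] H}
    (hqual : IsQualified g z₀ A₀) (hbot : g z₀ ≠ ⊥) :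
    ∃ κ, ∀ᶠ p : (E →L[ℝ] H) × H in 𝓝 (A₀, z₀), ∀ y ∈ subdiff g p.2,
      ‖y‖ ≤ κ * max ‖adjoint p.1 y‖ 1 := by
  obtain ⟨α, -, hα⟩ := EReal.lt_iff_exists_real_btwn.1 (bot_lt_iff_ne_bot.2 hbot)
  let B (A : E →L[ℝ] H) : L2Prod H ℝ →L[ℝ] E × ℝ :=
    (adjoint A ∘L WithLp.fstL 2 ℝ H ℝ).prod (WithLp.sndL 2 ℝ H ℝ)
  have hB : ∀ l ∈ convexNormalCone (epi g) (pair z₀ α), B A₀ l = 0 → l = 0 := fun l hl h0 =>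
    hqual.eq_zero_of_mem_convexNormalCone_epi hl (congrArg Prod.fst h0) (congrArg Prod.snd h0)
  obtain ⟨κ, hκ⟩ := exists_eventually_norm_le_of_convexNormalCone hB
  have hadj : Continuous fun p : (E →L[ℝ] H) × H => adjoint p.1 :=
    adjoint.continuous.comp continuous_fst
  have hBlim : Tendsto (fun p : (E →L[ℝ] H) × H => (B p.1, pair p.2 α)) (𝓝 (A₀, z₀))
      (𝓝 (B A₀, pair z₀ α)) :=
    (((ContinuousLinearMap.prodₗᵢ ℝ).continuous.comp
      ((hadj.clm_comp continuous_const).prodMk continuous_const)).prodMk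
        ((WithLp.prod_continuous_toLp 2 H ℝ).comp (by fun_prop))).tendsto _
  refine ⟨|κ|, ?_⟩
  filter_upwards [hBlim.eventually hκ,
    (continuous_snd.tendsto (A₀, z₀)).eventually (hlsc z₀ _ hα)] with p hp hαp y hy
  calc ‖y‖ ≤ ‖pair y (-1 : ℝ)‖ := WithLp.norm_fst_le _ (pair y (-1 : ℝ))
    _ ≤ κ * ‖B p.1 (pair y (-1))‖ :=
      hp _ (pair_neg_one_mem_convexNormalCone_of_mem_subdiff hconv hy hαp.le)
    _ ≤ |κ| * ‖B p.1 (pair y (-1))‖ := by gcongr; exact le_abs_self κ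
    _ = |κ| * max ‖adjoint p.1 y‖ 1 := by simp [B, Prod.norm_def]

theorem mem_subdiff_add_comp_iff [FiniteDimensional ℝ E] [FiniteDimensional ℝ H]
    (hφ₀ : ContDiff ℝ 1 φ₀) (hΦ : ContDiff ℝ 1 Φ) (hlsc : LowerSemicontinuous g)
    (hconv : IsConvex g) {e v : E} (hqual : IsQualified g (Φ e) (fderiv ℝ Φ e)) :
    v ∈ subdiff (fun e => (φ₀ e : EReal) + g (Φ e)) e ↔
      ∃ y ∈ subdiff g (Φ e), gradient φ₀ e + adjoint (fderiv ℝ Φ e) y = v := by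
  have hφ₀e := hφ₀.differentiable one_ne_zero e
  have hΦe := hΦ.differentiable one_ne_zero e
  refine ⟨?_, fun ⟨y, hy, h⟩ => h ▸ gradient_add_adjoint_mem_subdiff hconv hφ₀e hΦe hy⟩
  rintro ⟨htop', hbot', hN⟩
  have htop := coe_add_ne_top.1 htop'
  have hbot := coe_add_ne_bot.1 hbot'
  have hadj := adjoint_fderiv_epiMap (p := pair e ((φ₀ e : EReal) + g (Φ e)).toReal) hφ₀e hΦe
  rw [epi_add_comp] at hN
  obtain ⟨l, hl, hlv⟩ := exists_mem_convexNormalCone_of_mem_limitingNormalCone_preimage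
    (contDiff_epiMap hφ₀ hΦ) (isClosed_epi hlsc) hconv (fun l hl h0 => by
      rw [hadj] at h0
      have hsnd : l.snd = 0 := congrArg WithLp.snd h0
      refine hqual.eq_zero_of_mem_convexNormalCone_epi hl ?_ hsnd
      simpa [hsnd] using congrArg WithLp.fst h0) hN
  rw [hadj] at hlv
  have hsnd : l.snd = -1 := congrArg WithLp.snd hlv
  refine ⟨l.fst, (mem_subdiff_iff hconv).2 ⟨htop, hbot, ?_⟩, ?_⟩
  · rw [← epiMap_pair_toReal (φ₀ := φ₀) htop hbot, ← hsnd]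
    exact hl
  · simpa [hsnd, add_comm] using congrArg WithLp.fst hlv

end Subgradients

section GeneralizedEquations

open ContinuousLinearMap (fst snd)

variable {V U X Y : Type*}

/-- The solution mapping `(v, u, x) ↦ {y | v = Φ(x, y), y ∈ S(F(x) + u)}` of a parametrized
generalized equation. The multiplier mapping `mapY` has this form with `Φ = ∇ₓL` and `S = ∂g`. -/
def solutionMap [Add U] (Φ : X × Y → V) (F : X → U) (S : U → Set Y) :
    L2Prod (L2Prod V U) X → Set Y :=
  fun q => {y | y ∈ S (F q.snd + q.fst.snd) ∧ q.fst.fst = Φ (q.snd, y)}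

variable [NormedAddCommGroup V] [NormedAddCommGroup U] [NormedAddCommGroup X]
  [NormedAddCommGroup Y] {Φ : X × Y → V} {F : X → U} {S : U → Set Y}

lemma isClosed_gph_solutionMap (hΦ : Continuous Φ) (hF : Continuous F) (hS : IsClosed (gph S)) :
    IsClosed (gph (solutionMap Φ F S)) := by
  have hdata : Continuous fun p : L2Prod (L2Prod V U) X × Y =>
    (F p.1.snd + p.1.fst.snd, p.2) := by fun_prop
  exact (hS.preimage hdata).inter (isClosed_eq (by fun_prop) (by fun_prop))

variable [NormedSpace ℝ V] [NormedSpace ℝ U] [NormedSpace ℝ X] [NormedSpace ℝ Y]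
  {q d : L2Prod (L2Prod V U) X} {y e : Y}

lemma contDiff_pair {n : WithTop ℕ∞} {f : V → X} {h : V → Y} (hf : ContDiff ℝ n f)
    (hh : ContDiff ℝ n h) : ContDiff ℝ n fun v => pair (f v) (h v) :=
  (WithLp.prodContinuousLinearEquiv 2 ℝ X Y).symm.contDiff.comp (hf.prodMk hh)

lemma hasFDerivAt_pair {f : V → X} {h : V → Y} {f' : V →L[ℝ] X} {h' : V →L[ℝ] Y} {v : V}
    (hf : HasFDerivAt f f' v) (hh : HasFDerivAt h h' v) :
    HasFDerivAt (fun v => pair (f v) (h v))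
      ((WithLp.prodContinuousLinearEquiv 2 ℝ X Y).symm.toContinuousLinearMap ∘L f'.prod h') v :=
  (WithLp.prodContinuousLinearEquiv 2 ℝ X Y).symm.hasFDerivAt.comp v (hf.prodMk hh)

theorem mem_solutionMap_of_mem_limitingGraphicalDeriv (hΦ : ContDiff ℝ 1 Φ) (hF : ContDiff ℝ 1 F)
    (he : e ∈ limitingGraphicalDeriv (solutionMap Φ F S) q y d) :
    e ∈ solutionMap (fderiv ℝ Φ (q.snd, y)) (fderiv ℝ F q.snd)
      (limitingGraphicalDeriv S (F q.snd + q.fst.snd) y) d := by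
  let prX := WithLp.sndL 2 ℝ (L2Prod V U) X ∘L fst ℝ (L2Prod (L2Prod V U) X) Y
  let prVU := WithLp.fstL 2 ℝ (L2Prod V U) X ∘L fst ℝ (L2Prod (L2Prod V U) X) Y
  let prU := WithLp.sndL 2 ℝ V U ∘L prVU
  let prV := WithLp.fstL 2 ℝ V U ∘L prVU
  let prY := snd ℝ (L2Prod (L2Prod V U) X) Y
  let prXY := prX.prod prY
  have hFd := (hF.differentiable one_ne_zero q.snd).hasFDerivAt.comp (q, y) prX.hasFDerivAt
  have hΦd := (hΦ.differentiable one_ne_zero (q.snd, y)).hasFDerivAt.comp (q, y) prXY.hasFDerivAt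
  constructor
  · let data : L2Prod (L2Prod V U) X × Y → U × Y := fun p => (F p.1.snd + p.1.fst.snd, p.2)
    have hdata : HasFDerivAt data _ (q, y) :=
      (hFd.add prU.hasFDerivAt).prodMk prY.hasFDerivAt
    have hmap := map_mem_limitingTangentCone (f := data) (D := gph S)
      (((hF.comp prX.contDiff).add prU.contDiff).prodMk prY.contDiff)
      (eventually_nhdsWithin_of_forall fun _ hp => hp.1) he
    rwa [hdata.fderiv] at hmap
  · let residual : L2Prod (L2Prod V U) X × Y → V := fun p => p.1.fst.fst - Φ (p.1.snd, p.2)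
    have hresidual : HasFDerivAt residual _ (q, y) := prV.hasFDerivAt.sub hΦd
    have hzero := fderiv_eq_zero_of_mem_limitingTangentCone (f := residual)
      (prV.contDiff.sub (hΦ.comp prXY.contDiff)) (fun _ hp => sub_eq_zero.2 hp.2) he
    rw [hresidual.fderiv] at hzero
    exact sub_eq_zero.1 hzero

theorem mem_limitingGraphicalDeriv_solutionMap (hΦ : ContDiff ℝ 1 Φ) (hF : ContDiff ℝ 1 F)
    (hv : q.fst.fst = Φ (q.snd, y))
    (he : e ∈ solutionMap (fderiv ℝ Φ (q.snd, y)) (fderiv ℝ F q.snd)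
      (limitingGraphicalDeriv S (F q.snd + q.fst.snd) y) d) :
    e ∈ limitingGraphicalDeriv (solutionMap Φ F S) q y d := by
  let prXY := (fst ℝ X (U × Y)).prod (snd ℝ U Y ∘L snd ℝ X (U × Y))
  let prU := fst ℝ U Y ∘L snd ℝ X (U × Y)
  let Ψ : X × U × Y → L2Prod (L2Prod V U) X × Y :=
    fun p => (pair (pair (Φ (p.1, p.2.2)) (p.2.1 - F p.1)) p.1, p.2.2)
  have hΨ : ContDiff ℝ 1 Ψ :=
    (contDiff_pair (contDiff_pair (hΦ.comp prXY.contDiff) (prU.contDiff.sub (hF.comp contDiff_fst)))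
      contDiff_fst).prodMk (contDiff_snd.comp contDiff_snd)
  let p₀ : X × U × Y := (q.snd, F q.snd + q.fst.snd, y)
  have hFd := (hF.differentiable one_ne_zero q.snd).hasFDerivAt.comp p₀
    (fst ℝ X (U × Y)).hasFDerivAt
  have hΦd := (hΦ.differentiable one_ne_zero (q.snd, y)).hasFDerivAt.comp p₀ prXY.hasFDerivAt
  have hΨd : HasFDerivAt Ψ _ p₀ :=
    (hasFDerivAt_pair (hasFDerivAt_pair hΦd (prU.hasFDerivAt.sub hFd)) hasFDerivAt_fst).prodMk
      (snd ℝ U Y ∘L snd ℝ X (U × Y)).hasFDerivAt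
  have hΨp₀ : Ψ p₀ = (q, y) := by
    simp only [Ψ, p₀, add_sub_cancel_left, ← hv]
    rfl
  have hΨd₀ : fderiv ℝ Ψ p₀ (d.snd, fderiv ℝ F q.snd d.snd + d.fst.snd, e) = (d, e) := by
    have hd : fderiv ℝ F q.snd d.snd + d.fst.snd - fderiv ℝ F q.snd d.snd = d.fst.snd :=
      add_sub_cancel_left _ _
    rw [hΨd.fderiv]
    change (pair (pair (fderiv ℝ Φ (q.snd, y) (d.snd, e)) (fderiv ℝ F q.snd d.snd + d.fst.snd -
      fderiv ℝ F q.snd d.snd)) d.snd, e) = (d, e)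
    rw [hd, ← he.2]
    rfl
  have hgph : ∀ p ∈ Set.univ ×ˢ gph S, Ψ p ∈ gph (solutionMap Φ F S) := fun p hp =>
    ⟨by simpa [Ψ] using (show p.2.2 ∈ S p.2.1 from hp.2), rfl⟩
  have hmap := map_mem_limitingTangentCone hΨ (eventually_nhdsWithin_of_forall hgph)
    (prodMk_mem_limitingTangentCone_univ_prod q.snd d.snd he.1)
  rwa [hΨd₀, hΨp₀] at hmap

theorem mem_limitingGraphicalDeriv_solutionMap_iff (hΦ : ContDiff ℝ 1 Φ) (hF : ContDiff ℝ 1 F)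
    (hv : q.fst.fst = Φ (q.snd, y)) :
    e ∈ limitingGraphicalDeriv (solutionMap Φ F S) q y d ↔
      e ∈ solutionMap (fderiv ℝ Φ (q.snd, y)) (fderiv ℝ F q.snd)
        (limitingGraphicalDeriv S (F q.snd + q.fst.snd) y) d :=
  ⟨mem_solutionMap_of_mem_limitingGraphicalDeriv hΦ hF,
    mem_limitingGraphicalDeriv_solutionMap hΦ hF hv⟩

end GeneralizedEquations

section Lagrangian

open ContinuousLinearMap (adjoint)

variable {n m : ℕ} {f₀ : R n → ℝ} {F : R n → R m}

/-- The gradient `∇ₓL(x, y) = ∇f₀(x) + F'(x)ᵀ y` of the Lagrangian, as a function of the pair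
`(x, y)`. -/
noncomputable def lagrangianGradient (f₀ : R n → ℝ) (F : R n → R m) : R n × R m → R n :=
  fun p => gradient f₀ p.1 + adjoint (fderiv ℝ F p.1) p.2

lemma contDiff_lagrangianGradient (hf₀ : ContDiff ℝ 2 f₀) (hF : ContDiff ℝ 2 F) :
    ContDiff ℝ 1 (lagrangianGradient f₀ F) := by
  refine contDiff_euclidean.2 fun i => ?_
  have hcoord : (fun p => lagrangianGradient f₀ F p i) = fun p : R n × R m =>
      fderiv ℝ f₀ p.1 (EuclideanSpace.single i 1) +
        inner ℝ p.2 (fderiv ℝ F p.1 (EuclideanSpace.single i 1)) := by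
    ext p
    rw [← inner_gradient_left, ← ContinuousLinearMap.adjoint_inner_left, ← inner_add_left,
      EuclideanSpace.inner_single_right]
    simp [lagrangianGradient]
  have hf₀' : ContDiff ℝ 1 fun p : R n × R m => fderiv ℝ f₀ p.1 :=
    (hf₀.fderiv_right one_add_one_eq_two.le).comp contDiff_fst
  have hF' : ContDiff ℝ 1 fun p : R n × R m => fderiv ℝ F p.1 :=
    (hF.fderiv_right one_add_one_eq_two.le).comp contDiff_fst
  rw [hcoord]
  exact (hf₀'.clm_apply contDiff_const).add
    (contDiff_snd.inner ℝ (hF'.clm_apply contDiff_const))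

lemma gradient_lagrangian {x : R n} (hf₀ : DifferentiableAt ℝ f₀ x)
    (hF : DifferentiableAt ℝ F x) (y : R m) :
    gradient (fun x' => lagrangian f₀ F x' y) x = lagrangianGradient f₀ F (x, y) := by
  refine ext_inner_right ℝ fun w => ?_
  have hderiv : HasFDerivAt (fun x' => lagrangian f₀ F x' y)
      (fderiv ℝ f₀ x + (innerSL ℝ y).comp (fderiv ℝ F x)) x :=
    hf₀.hasFDerivAt.add ((innerSL ℝ y).hasFDerivAt.comp x hF.hasFDerivAt)
  rw [inner_gradient_left, hderiv.fderiv, lagrangianGradient, inner_add_left,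
    inner_gradient_left, ContinuousLinearMap.adjoint_inner_left]
  rfl

lemma hessLagrangian_add_adjoint (hf₀ : ContDiff ℝ 2 f₀) (hF : ContDiff ℝ 2 F) (x : R n)
    (y : R m) (dx : R n) (dy : R m) :
    hessLagrangian f₀ F x y dx + adjoint (fderiv ℝ F x) dy =
      fderiv ℝ (lagrangianGradient f₀ F) (x, y) (dx, dy) := by
  have hL := ((contDiff_lagrangianGradient hf₀ hF).differentiable one_ne_zero
    (x, y)).hasFDerivAt
  have hx : HasFDerivAt (fun x' => lagrangianGradient f₀ F (x', y)) _ x :=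
    HasFDerivAt.comp (g := lagrangianGradient f₀ F) x hL (hasFDerivAt_prodMk_left x y)
  have hy : HasFDerivAt (fun y' => lagrangianGradient f₀ F (x, y')) _ y :=
    HasFDerivAt.comp (g := lagrangianGradient f₀ F) y hL (hasFDerivAt_prodMk_right x y)
  have hy' : HasFDerivAt (fun y' => lagrangianGradient f₀ F (x, y')) (adjoint (fderiv ℝ F x)) y :=
    HasFDerivAt.const_add (gradient f₀ x) (adjoint (fderiv ℝ F x)).hasFDerivAt
  have hgrad : (fun x' => gradient (fun x'' => lagrangian f₀ F x'' y) x') =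
      fun x' => lagrangianGradient f₀ F (x', y) :=
    funext fun x' => gradient_lagrangian (hf₀.differentiable two_ne_zero x')
      (hF.differentiable two_ne_zero x') y
  rw [← hy.unique hy', hessLagrangian, hgrad, hx.fderiv]
  simp [← map_add]

end Lagrangian

section Multipliers

open ContinuousLinearMap (adjoint)

lemma adjoint_fderiv_comp_fst_add_snd {X Z : Type*} [NormedAddCommGroup X]
    [InnerProductSpace ℝ X] [CompleteSpace X] [NormedAddCommGroup Z] [InnerProductSpace ℝ Z]
    [CompleteSpace Z] {F : X → Z} {e : L2Prod X Z} (hF : DifferentiableAt ℝ F e.fst) (y : Z) :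
    adjoint (fderiv ℝ (fun e : L2Prod X Z => F e.fst + e.snd) e) y =
      pair (adjoint (fderiv ℝ F e.fst) y) y := by
  have hderiv : HasFDerivAt (fun e : L2Prod X Z => F e.fst + e.snd)
      (fderiv ℝ F e.fst ∘L WithLp.fstL 2 ℝ X Z + WithLp.sndL 2 ℝ X Z) e :=
    (hF.hasFDerivAt.comp e (WithLp.fstL 2 ℝ X Z).hasFDerivAt).add
      (WithLp.sndL 2 ℝ X Z).hasFDerivAt
  refine ext_inner_right ℝ fun w => ?_
  rw [ContinuousLinearMap.adjoint_inner_left, hderiv.fderiv]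
  simp [inner_add_right, ContinuousLinearMap.adjoint_inner_left]

lemma gradient_comp_fst {X Z : Type*} [NormedAddCommGroup X] [InnerProductSpace ℝ X]
    [CompleteSpace X] [NormedAddCommGroup Z] [InnerProductSpace ℝ Z] [CompleteSpace Z]
    {f₀ : X → ℝ} {e : L2Prod X Z} (hf₀ : DifferentiableAt ℝ f₀ e.fst) :
    gradient (fun e : L2Prod X Z => f₀ e.fst) e = pair (gradient f₀ e.fst) 0 := by
  have hderiv : HasFDerivAt (fun e : L2Prod X Z => f₀ e.fst)
      (fderiv ℝ f₀ e.fst ∘L WithLp.fstL 2 ℝ X Z) e :=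
    hf₀.hasFDerivAt.comp e (WithLp.fstL 2 ℝ X Z).hasFDerivAt
  refine ext_inner_right ℝ fun w => ?_
  rw [inner_gradient_left, hderiv.fderiv]
  simp

variable {n m : ℕ} {f₀ : R n → ℝ} {F : R n → R m} {g : R m → EReal}
  {q d : L2Prod (L2Prod (R n) (R m)) (R n)} {y e : R m}

theorem mem_mapY_iff (hf₀ : ContDiff ℝ 1 f₀) (hF : ContDiff ℝ 1 F)
    (hlsc : LowerSemicontinuous g) (hconv : IsConvex g) :
    y ∈ mapY (composite f₀ F g) q ↔ y ∈ subdiff g (F q.snd + q.fst.snd) ∧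
      q.fst.fst = lagrangianGradient f₀ F (q.snd, y) := by
  have hfst : ContDiff ℝ 1 fun e : L2Prod (R n) (R m) => e.fst :=
    (WithLp.fstL 2 ℝ (R n) (R m)).contDiff
  have hφ₀ : ContDiff ℝ 1 fun e : L2Prod (R n) (R m) => f₀ e.fst := hf₀.comp hfst
  have hΦ : ContDiff ℝ 1 fun e : L2Prod (R n) (R m) => F e.fst + e.snd :=
    (hF.comp hfst).add (WithLp.sndL 2 ℝ (R n) (R m)).contDiff
  set e : L2Prod (R n) (R m) := pair q.snd q.fst.snd
  have hadj := adjoint_fderiv_comp_fst_add_snd (e := e) (hF.differentiable one_ne_zero q.snd)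
  have hqual : IsQualified g (F e.fst + e.snd)
      (fderiv ℝ (fun e : L2Prod (R n) (R m) => F e.fst + e.snd) e) := fun y _ h0 => by
    rw [hadj] at h0
    exact congrArg WithLp.snd h0
  have hgrad := gradient_comp_fst (e := e) (hf₀.differentiable one_ne_zero q.snd)
  refine (mem_subdiff_add_comp_iff hφ₀ hΦ hlsc hconv hqual).trans ?_
  simp only [hadj, hgrad, ← WithLp.toLp_add, Prod.mk_add_mk, zero_add]
  constructor
  · rintro ⟨y', hy', h⟩
    obtain rfl : y' = y := congrArg WithLp.snd h
    exact ⟨hy', (congrArg WithLp.fst h).symm⟩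
  · rintro ⟨hy, h⟩
    exact ⟨y, hy, by rw [h]; rfl⟩

theorem snd_mem_mapM_of_mem_dom_mapY (hf₀ : ContDiff ℝ 1 f₀) (hF : ContDiff ℝ 1 F)
    (hlsc : LowerSemicontinuous g) (hconv : IsConvex g)
    (hq : q ∈ dom (mapY (composite f₀ F g))) : q.snd ∈ mapM (composite f₀ F g) q.fst := by
  obtain ⟨y, hy⟩ := hq
  obtain ⟨hyg, hv⟩ := (mem_mapY_iff hf₀ hF hlsc hconv).1 hy
  have hsub := gradient_add_adjoint_mem_subdiff hconv
    (hf₀.differentiable one_ne_zero q.snd)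
    ((hF.differentiable one_ne_zero q.snd).add_const q.fst.snd) hyg
  rw [fderiv_add_const] at hsub
  rw [mapM, Set.mem_ofPred_eq, hv]
  exact hsub

theorem mem_dom_mapY_of_snd_mem_mapM (hf₀ : ContDiff ℝ 1 f₀) (hF : ContDiff ℝ 1 F)
    (hlsc : LowerSemicontinuous g) (hconv : IsConvex g)
    (hqual : IsQualified g (F q.snd + q.fst.snd) (fderiv ℝ F q.snd))
    (hq : q.snd ∈ mapM (composite f₀ F g) q.fst) : q ∈ dom (mapY (composite f₀ F g)) := by
  have hqual' : IsQualified g (F q.snd + q.fst.snd)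
      (fderiv ℝ (fun x => F x + q.fst.snd) q.snd) := by rwa [fderiv_add_const]
  obtain ⟨y, hy, hv⟩ := (mem_subdiff_add_comp_iff hf₀ (hF.add contDiff_const) hlsc hconv
    hqual').1 hq
  rw [fderiv_add_const] at hv
  exact ⟨y, (mem_mapY_iff hf₀ hF hlsc hconv).2 ⟨hy, hv.symm⟩⟩

lemma mapY_composite_eq (hf₀ : ContDiff ℝ 1 f₀) (hF : ContDiff ℝ 1 F)
    (hlsc : LowerSemicontinuous g) (hconv : IsConvex g) :
    mapY (composite f₀ F g) = solutionMap (lagrangianGradient f₀ F) F (subdiff g) :=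
  funext fun _ => Set.ext fun _ => mem_mapY_iff hf₀ hF hlsc hconv

lemma isClosed_gph_mapY (hf₀ : ContDiff ℝ 2 f₀) (hF : ContDiff ℝ 2 F) (hg : IsProper g)
    (hlsc : LowerSemicontinuous g) (hconv : IsConvex g) :
    IsClosed (gph (mapY (composite f₀ F g))) := by
  rw [mapY_composite_eq (hf₀.of_le one_le_two) (hF.of_le one_le_two) hlsc hconv]
  exact isClosed_gph_solutionMap (contDiff_lagrangianGradient hf₀ hF).continuous hF.continuous
    (isClosed_gph_subdiff hg hlsc hconv)

lemma tendsto_fderiv_prodMk_add (hF : ContDiff ℝ 1 F) :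
    Tendsto (fun q : L2Prod (L2Prod (R n) (R m)) (R n) =>
      (fderiv ℝ F q.snd, F q.snd + q.fst.snd)) (𝓝 q)
      (𝓝 (fderiv ℝ F q.snd, F q.snd + q.fst.snd)) := by
  have hFc := hF.continuous
  have := hF.continuous_fderiv one_ne_zero
  exact Continuous.tendsto (by fun_prop) q

theorem exists_eventually_norm_le_of_mem_mapY (hf₀ : ContDiff ℝ 2 f₀) (hF : ContDiff ℝ 2 F)
    (hlsc : LowerSemicontinuous g) (hconv : IsConvex g) (hbot : g (F q.snd + q.fst.snd) ≠ ⊥)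
    (hqual : IsQualified g (F q.snd + q.fst.snd) (fderiv ℝ F q.snd)) :
    ∃ r, ∀ᶠ q' in 𝓝 q, ∀ y ∈ mapY (composite f₀ F g) q', ‖y‖ ≤ r := by
  have hf1 := hf₀.of_le one_le_two
  have hF1 := hF.of_le one_le_two
  have hLc := (contDiff_lagrangianGradient hf₀ hF).continuous
  let c (q' : L2Prod (L2Prod (R n) (R m)) (R n)) : R n :=
    q'.fst.fst - lagrangianGradient f₀ F (q'.snd, 0)
  have hc : Continuous c := by fun_prop
  obtain ⟨κ, hκ⟩ := hqual.exists_eventually_norm_le_of_mem_subdiff hlsc hconv hbot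
  refine ⟨|κ| * max (‖c q‖ + 1) 1, ?_⟩
  filter_upwards [(tendsto_fderiv_prodMk_add hF1).eventually hκ,
    (hc.norm.tendsto q).eventually_lt_const (lt_add_one _)] with q' hq' hcq' y hy
  obtain ⟨hyg, hv⟩ := (mem_mapY_iff hf1 hF1 hlsc hconv).1 hy
  have hadj : adjoint (fderiv ℝ F q'.snd) y = c q' := by
    simp [c, hv, lagrangianGradient]
  calc ‖y‖ ≤ κ * max ‖adjoint (fderiv ℝ F q'.snd) y‖ 1 := hq' y hyg
    _ ≤ |κ| * max (‖c q‖ + 1) 1 := by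
      rw [hadj]
      gcongr
      exact le_abs_self κ

lemma BasicCQ.isQualified {x : R n} (hCQ : BasicCQ F g x) (htop : g (F x) ≠ ⊤)
    (hbot : g (F x) ≠ ⊥) : IsQualified g (F x) (fderiv ℝ F x) := fun y hy h0 =>
  hCQ y h0 (convexNormalCone_dom_subset_singularSubdiff htop hbot hy)

end Multipliers

section GraphicalDerivatives

section WithLp

variable {X Z : Type*} [NormedAddCommGroup X] [InnerProductSpace ℝ X]
  [NormedAddCommGroup Z] [InnerProductSpace ℝ Z] {C : Set (L2Prod X Z)} {D : Set (X × Z)}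
  {q d : L2Prod X Z}

lemma prodMk_mem_limitingTangentCone (hCD : ∀ q' ∈ C, (q'.fst, q'.snd) ∈ D)
    (hd : d ∈ limitingTangentCone C q) :
    (d.fst, d.snd) ∈ limitingTangentCone D (q.fst, q.snd) := by
  let ofLp := (WithLp.prodContinuousLinearEquiv 2 ℝ X Z).toContinuousLinearMap
  have hmap := map_mem_limitingTangentCone ofLp.contDiff (eventually_nhdsWithin_of_forall hCD) hd
  rwa [ofLp.fderiv] at hmap

lemma mem_limitingTangentCone_of_prodMk_mem
    (hDC : ∀ᶠ q' in 𝓝 q, (q'.fst, q'.snd) ∈ D → q' ∈ C)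
    (hd : (d.fst, d.snd) ∈ limitingTangentCone D (q.fst, q.snd)) :
    d ∈ limitingTangentCone C q := by
  let toLp := (WithLp.prodContinuousLinearEquiv 2 ℝ X Z).symm.toContinuousLinearMap
  have hmap := map_mem_limitingTangentCone toLp.contDiff (eventually_nhdsWithin_iff.2
    ((toLp.continuous.tendsto (q.fst, q.snd)).eventually hDC)) hd
  rwa [toLp.fderiv] at hmap

end WithLp

variable {n m : ℕ} {f₀ : R n → ℝ} {F : R n → R m} {g : R m → EReal}
  {q d : L2Prod (L2Prod (R n) (R m)) (R n)} {y e : R m}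

lemma snd_mem_limitingGraphicalDeriv_mapM (hf₀ : ContDiff ℝ 1 f₀) (hF : ContDiff ℝ 1 F)
    (hlsc : LowerSemicontinuous g) (hconv : IsConvex g)
    (hd : d ∈ limitingTangentCone (dom (mapY (composite f₀ F g))) q) :
    d.snd ∈ limitingGraphicalDeriv (mapM (composite f₀ F g)) q.fst q.snd d.fst :=
  prodMk_mem_limitingTangentCone
    (fun _ hq' => snd_mem_mapM_of_mem_dom_mapY hf₀ hF hlsc hconv hq') hd

lemma mem_limitingTangentCone_dom_mapY (hf₀ : ContDiff ℝ 1 f₀) (hF : ContDiff ℝ 1 F)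
    (hlsc : LowerSemicontinuous g) (hconv : IsConvex g)
    (hqual : IsQualified g (F q.snd + q.fst.snd) (fderiv ℝ F q.snd))
    (hd : d.snd ∈ limitingGraphicalDeriv (mapM (composite f₀ F g)) q.fst q.snd d.fst) :
    d ∈ limitingTangentCone (dom (mapY (composite f₀ F g))) q := by
  refine mem_limitingTangentCone_of_prodMk_mem ?_ hd
  filter_upwards [(tendsto_fderiv_prodMk_add hF).eventually hqual.eventually] with q' hq' hq'M
    using mem_dom_mapY_of_snd_mem_mapM hf₀ hF hlsc hconv hq' hq'M

theorem stronglyNoncritical_iff (hf₀ : ContDiff ℝ 2 f₀) (hF : ContDiff ℝ 2 F)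
    (hlsc : LowerSemicontinuous g) (hconv : IsConvex g) {x : R n}
    (hy : y ∈ mapY (composite f₀ F g) (pair (pair 0 0) x)) :
    StronglyNoncritical f₀ F g x y ↔ ∀ dx dy,
      dy ∈ limitingGraphicalDeriv (mapY (composite f₀ F g)) (pair (pair 0 0) x) y
        (pair (pair 0 0) dx) → dx = 0 := by
  have hf1 := hf₀.of_le one_le_two
  have hF1 := hF.of_le one_le_two
  rw [mapY_composite_eq hf1 hF1 hlsc hconv]
  refine forall₂_congr fun dx dy => ?_
  rw [mem_limitingGraphicalDeriv_solutionMap_iff (contDiff_lagrangianGradient hf₀ hF) hF1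
    ((mem_mapY_iff hf1 hF1 hlsc hconv).1 hy).2, hessLagrangian_add_adjoint hf₀ hF]
  simp only [solutionMap, Set.mem_ofPred_eq, WithLp.toLp_fst, WithLp.toLp_snd, add_zero]
  rw [and_comm, eq_comm, and_imp]

end GraphicalDerivatives

end CritMult

theorem mainTheorem5 (n m : ℕ) (f₀ : CritMult.R n → ℝ) (F : CritMult.R n → CritMult.R m)
    (g : CritMult.R m → EReal)
    (hf₀ : ContDiff ℝ 2 f₀) (hF : ContDiff ℝ 2 F)
    (hg_proper : CritMult.IsProper g) (hg_lsc : LowerSemicontinuous g)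
    (hg_convex : CritMult.IsConvex g)
    (xbar : CritMult.R n)
    (hx : (0 : CritMult.R n) ∈
      CritMult.subdiff (fun x => CritMult.composite f₀ F g (CritMult.pair x 0)) xbar) :
    (CritMult.IsolatedlyCalmAround (CritMult.mapM (CritMult.composite f₀ F g))
        (CritMult.pair 0 0) xbar →
      (∀ y ∈ CritMult.mapY (CritMult.composite f₀ F g)
          (CritMult.pair (CritMult.pair 0 0) xbar),
        CritMult.StronglyNoncritical f₀ F g xbar y) ∧
      ∀ dx : CritMult.R n, dx ≠ 0 →
        CritMult.LocallyUniformlyFuzzyInnerCalm (CritMult.mapY (CritMult.composite f₀ F g))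
          (CritMult.pair (CritMult.pair 0 0) xbar)
          (CritMult.pair (CritMult.pair 0 0) dx)) ∧
    (CritMult.BasicCQ F g xbar →
      (∀ y ∈ CritMult.mapY (CritMult.composite f₀ F g)
          (CritMult.pair (CritMult.pair 0 0) xbar),
        CritMult.StronglyNoncritical f₀ F g xbar y) →
      (∀ dx : CritMult.R n, dx ≠ 0 →
        CritMult.LocallyUniformlyFuzzyInnerCalm (CritMult.mapY (CritMult.composite f₀ F g))
          (CritMult.pair (CritMult.pair 0 0) xbar)
          (CritMult.pair (CritMult.pair 0 0) dx)) →
      CritMult.IsolatedlyCalmAround (CritMult.mapM (CritMult.composite f₀ F g))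
        (CritMult.pair 0 0) xbar) := by
  open CritMult in
  have hf1 := hf₀.of_le one_le_two
  have hF1 := hF.of_le one_le_two
  rw [isolatedlyCalmAround_iff]
  refine ⟨fun hM => ?_, fun hCQ hnoncrit hcalm dx hdx => ?_⟩
  · have hdom : ∀ dx, pair (pair 0 0) dx ∈ limitingTangentCone (dom (mapY (composite f₀ F g)))
        (pair (pair 0 0) xbar) → dx = 0 := fun dx hdx =>
      hM dx (snd_mem_limitingGraphicalDeriv_mapM hf1 hF1 hg_lsc hg_convex hdx)
    exact ⟨fun y hy => (stronglyNoncritical_iff hf₀ hF hg_lsc hg_convex hy).2 fun dx _ he =>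
        hdom dx (mem_limitingTangentCone_dom he),
      fun dx hdx => locallyUniformlyFuzzyInnerCalm_of_notMem (mt (hdom dx) hdx)⟩
  · have htop : g (F xbar) ≠ ⊤ := by simpa [composite, coe_add_ne_top, -ne_eq] using hx.1
    have hqual : IsQualified g (F xbar + 0) (fderiv ℝ F xbar) := by
      simpa only [add_zero] using hCQ.isQualified htop (hg_proper.ne_bot _)
    by_contra hne
    have htangent := mem_limitingTangentCone_dom_mapY (q := pair (pair 0 0) xbar)
      (d := pair (pair 0 0) dx) hf1 hF1 hg_lsc hg_convex hqual hdx
    obtain ⟨r, hr⟩ := exists_eventually_norm_le_of_mem_mapY (q := pair (pair 0 0) xbar)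
      hf₀ hF hg_lsc hg_convex (hg_proper.ne_bot _) hqual
    obtain ⟨y, hy, dy, hdy⟩ := exists_mem_limitingTangentCone_gph
      (isClosed_gph_mapY hf₀ hF hg_proper hg_lsc hg_convex) hr (hcalm dx hne) htangent
    exact hne ((stronglyNoncritical_iff hf₀ hF hg_lsc hg_convex hy).1 (hnoncrit y hy) dx dy hdy)
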